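/- For $0<\lambda<1$ and $0\le k\le 1$ let $$F(\lambda,k)=\int_0^\lambda\frac{dt}{\sqrt{(1-t^2)(1-k^2t^2)}}$$ be Legendre's first incomplete elliptic integral, and write $(a)_n=a(a+1)\cdots(a+n-1)$, $(a)_0=1$. Define $s_n(x)$, for $n\ge 0$ and $x>-1$, by the starting values $$s_0(x)=-2\ln\frac{1+\sqrt{1+x}}{2},\qquad s_1(x)=\Big(\frac x2-1\Big)\ln\frac{1+\sqrt{1+x}}{2}-\frac12\sqrt{1+x}+\frac12+\frac x2,$$ $$s_2(x)=\Big(-\frac{9}{32}x^2+\frac x4-\frac34\Big)\ln\frac{1+\sqrt{1+x}}{2}+\Big(\frac{9}{32}x-\frac{7}{16}\Big)\sqrt{1+x}+\frac{7}{16}+\frac x8-\frac{21}{64}x^2$$ and the four-term recurrence $$4(n+3)^2s_{n+3}(x)=a_n(x)s_{n+2}(x)+b_n(x)s_{n+1}(x)+c_n(x)s_n(x)+h_n(x)\qquad(n\ge 0),$$ where $a_n(x)=8n^2+36n+42-x(2n+5)^2$, $b_n(x)=2x(4n^2+14n+13)-(2n+3)^2$, $c_n(x)=-4x(n+1)^2$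 and $$h_n(x)=\frac{x(2n+5)(2n+3)^2+(n+3)(8n^2+24n+17)}{8(n+3)[(n+2)!]^2}\,[(3/2)_n]^2(-x)^{n+2}.$$ For $N\ge 1$, $0<\lambda<1$ and $0\le k<1$ put $\alpha=\frac{(N+1/2)^2}{(N+1)^2}$, $S=\sqrt{1+\frac{1-\lambda^2}{\alpha\lambda^2(1-k^2)}}$ and $$f_N(\lambda,k)=\frac{1}{1-\alpha(1-k^2)}\left\{\frac{1}{\alpha\lambda S}\ln\frac{S+1}{S-1}-(1-k^2)\ln\frac{1+\lambda}{1-\lambda}\right\},$$ and let $f_N(\lambda,1)=0$ (the limit as $k\to1$). Then the following hold. (1) For all $n\ge0$ and $|x|<1$, $$s_n(x)=\sum_{j=n+1}^{\infty}\frac{(1/2)_j(1/2-j)_n}{j!\,j\,(1-j)_n}(-x)^j .$$ (2) For all $0<\lambda<1$, $0\le k\le1$ and every integer $N\ge1$, $$F(\lambda,k)=\frac12\ln\frac{1+\lambda}{1-\lambda}\sum_{j=0}^{N}\frac{[(1/2)_j]^2}{(j!)^2}(1-k^2)^j+\frac1{2\lambda}\sum_{n=0}^{N-1}\left(\frac{1-\lambda^2}{-\lambda^2}\right)^{n}s_n\!\left(\frac{(1-k^2)\lambda^2}{1-\lambda^2}\right)+R_N(\lambda,k),$$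 where the remainder satisfies $R_N(\lambda,k)<0$ if $k<1$, $R_N(\lambda,1)=0$, and $$\frac{[(1/2)_{N+1}]^2(1-k^2)^N}{2[(N+1)!]^2}f_{N+1}(\lambda,k)\le -R_N(\lambda,k)\le\frac{[(1/2)_{N+1}]^2(1-k^2)^N}{2[(N+1)!]^2}f_{N}(\lambda,k).$$ (3) For $0<\lambda<1$, $0\le k<1$ and $N\ge1$: $f_N(\lambda,k)>0$ and $f_{N+1}(\lambda,k)<f_N(\lambda,k)$. (4) For each $N\ge1$, $f_N$ is bounded on every set $E\subseteq(0,1)\times[0,1]$ with $\sup_{(\lambda,k)\in E}\frac{1-k}{1-\lambda}<\infty$. -/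

import Mathlib

noncomputable section

namespace EllipticExpansion

/-- Legendre's first incomplete elliptic integral
`F(lam, k) = ∫₀^lam dt / √((1 - t²)(1 - k² t²))`. -/
def ellipticF (lam k : ℝ) : ℝ :=
  ∫ t in (0 : ℝ)..lam, 1 / Real.sqrt ((1 - t ^ 2) * (1 - k ^ 2 * t ^ 2))

/-- The Pochhammer symbol `(a)_n = a (a + 1) ⋯ (a + n - 1)`, with `(a)_0 = 1`. -/
def poch (a : ℝ) (n : ℕ) : ℝ := (ascPochhammer ℝ n).eval a

/-- The coefficient `a_n(x)` of the recurrence for `s_n`. -/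
def coefA (n : ℕ) (x : ℝ) : ℝ :=
  8 * (n : ℝ) ^ 2 + 36 * n + 42 - x * (2 * n + 5) ^ 2

/-- The coefficient `b_n(x)` of the recurrence for `s_n`. -/
def coefB (n : ℕ) (x : ℝ) : ℝ :=
  2 * x * (4 * (n : ℝ) ^ 2 + 14 * n + 13) - (2 * n + 3) ^ 2

/-- The coefficient `c_n(x)` of the recurrence for `s_n`. -/
def coefC (n : ℕ) (x : ℝ) : ℝ :=
  -4 * x * ((n : ℝ) + 1) ^ 2

/-- The inhomogeneous term `h_n(x)` of the recurrence for `s_n`. -/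
def termH (n : ℕ) (x : ℝ) : ℝ :=
  (x * (2 * (n : ℝ) + 5) * (2 * n + 3) ^ 2 + (n + 3) * (8 * n ^ 2 + 24 * n + 17)) /
      (8 * (n + 3) * (Nat.factorial (n + 2) : ℝ) ^ 2) *
    poch (3 / 2) n ^ 2 * (-x) ^ (n + 2)

/-- The elementary functions `s_n(x)`, given by their starting values for `n = 0, 1, 2` and the
four-term recurrence
`4 (n + 3)² s_{n+3} = a_n(x) s_{n+2} + b_n(x) s_{n+1} + c_n(x) s_n + h_n(x)`. -/
def s : ℕ → ℝ → ℝ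
  | 0, x => -2 * Real.log ((1 + Real.sqrt (1 + x)) / 2)
  | 1, x =>
      (x / 2 - 1) * Real.log ((1 + Real.sqrt (1 + x)) / 2)
        - 1 / 2 * Real.sqrt (1 + x) + 1 / 2 + x / 2
  | 2, x =>
      (-(9 / 32) * x ^ 2 + x / 4 - 3 / 4) * Real.log ((1 + Real.sqrt (1 + x)) / 2)
        + (9 / 32 * x - 7 / 16) * Real.sqrt (1 + x) + 7 / 16 + 1 / 8 * x - 21 / 64 * x ^ 2
  | n + 3, x =>
      (coefA n x * s (n + 2) x + coefB n x * s (n + 1) x + coefC n x * s n x + termH n x) /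
        (4 * ((n : ℝ) + 3) ^ 2)

/-- The `j`-th term `(1/2)_j (1/2 - j)_n / (j! j (1 - j)_n) (-x)^j`, `j ≥ n + 1`, of the power
series of `s_n`. -/
def sTerm (n : ℕ) (x : ℝ) (j : ℕ) : ℝ :=
  poch (1 / 2) j * poch (1 / 2 - (j : ℝ)) n /
      ((Nat.factorial j : ℝ) * j * poch (1 - (j : ℝ)) n) * (-x) ^ j

/-- `α_N = (N + 1/2)² / (N + 1)²`. -/
def alpha (N : ℕ) : ℝ := ((N : ℝ) + 1 / 2) ^ 2 / ((N : ℝ) + 1) ^ 2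

/-- The quantity `√(1 + (1 - lam²) / (α_N lam² (1 - k²)))` (for `0 < lam < 1`, `0 ≤ k < 1`). -/
def rootTerm (N : ℕ) (lam k : ℝ) : ℝ :=
  Real.sqrt (1 + (1 - lam ^ 2) / (alpha N * lam ^ 2 * (1 - k ^ 2)))

/-- The elementary function `f_N(lam, k)` of the error bound, for `0 < lam < 1`, `0 ≤ k ≤ 1`. On the
side `k = 1`, where the formula divides by `1 - k² = 0`, it takes its limiting value `0`. -/
def f (N : ℕ) (lam k : ℝ) : ℝ :=
  if k = 1 then 0
  else
    1 / (1 - alpha N * (1 - k ^ 2)) *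
      (1 / (alpha N * lam * rootTerm N lam k) *
          Real.log ((rootTerm N lam k + 1) / (rootTerm N lam k - 1))
        - (1 - k ^ 2) * Real.log ((1 + lam) / (1 - lam)))

/-- The explicit part of the expansion of order `N`. -/
def expansion (N : ℕ) (lam k : ℝ) : ℝ :=
  1 / 2 * Real.log ((1 + lam) / (1 - lam)) *
      ∑ j ∈ Finset.range (N + 1),
        poch (1 / 2) j * poch (1 / 2) j / (Nat.factorial j : ℝ) ^ 2 * (1 - k ^ 2) ^ j
    + 1 / (2 * lam) *
      ∑ n ∈ Finset.range N,
        ((1 - lam ^ 2) / (-lam ^ 2)) ^ n * s n ((1 - k ^ 2) * lam ^ 2 / (1 - lam ^ 2))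

/-- The factor `[(1/2)_{N+1}]² (1 - k²)^N / (2 [(N+1)!]²)` of the error bound. -/
def errCoef (N : ℕ) (k : ℝ) : ℝ :=
  poch (1 / 2) (N + 1) ^ 2 * (1 - k ^ 2) ^ N / (2 * (Nat.factorial (N + 1) : ℝ) ^ 2)

end EllipticExpansion

end

namespace EllipticExpansion

open MeasureTheory Filter Topology
open scoped Real

/-! Everything is reduced to integrals over three angles. Write `m = 1 - k²`, `U = lam² / (1 -
lam²)`, `v = U sin² ψ` and `T = sin² θ sin² φ`. Poisson's integral, used twice, and a substitution
give `F = U / (2 π² lam) ∫ sin ψ / ((1 + v) (1 + m v T))` over `(0, π]³`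
(`ellipticF_eq_integral_triple`), and the average of `T^j` is `((1/2)_j / j!)²`.

The identity `(1 - m T) v / ((1 + v) (1 + m v T)) = 1 / (1 + m v T) - 1 / (1 + v)`, integrated
against `T^(N+1) sin ψ`, splits off one order of the expansion: the last term gives the logarithm
times a moment of `T`, the middle one gives `s_N(m U)`, and what is left is the remainder of the
next order (`remInt_sub_remInt_succ`). This needs `s_n(x) = (-x)^(n+1) / π² ∫ T^(n+1) sin ψ / (1 + x
T sin² ψ)` for all `x > -1` (`s_eq_sInt`). For `|x| < 1` both sides have the same power series,
since the series satisfy the starting values and the recurrence (`hasSum_s`); analyticity on `(-1,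
∞)` extends the equality.

The remainder is minus an integral of `T^(N+1) / (1 + a T)`, `a ≥ 0`, with a nonnegative weight.
Jensen's inequality replaces `T` in the denominator by its mean `α_{N+1}` for the density
proportional to `T^(N+1)` (lower bound) or `α_N` for `T^N` (upper bound). The integral with `T`
constant is elementary and is `f` up to a factor (`f_eq_fInt`), from which positivity, monotonicity
and boundedness are read off. -/

/-! ### Parametric integrals of `1 / (1 + x T)` -/

theorem one_add_mul_pos {z t : ℝ} (hz : -1 < z) (h0 : 0 ≤ t) (h1 : t ≤ 1) : 0 < 1 + z * t := by
  rcases h0.eq_or_lt with rfl | h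
  · simp
  · nlinarith

/-- A parametric integral of `1 / (1 + x T)` with `0 ≤ T ≤ 1` expands about each `x₀ > -1`. -/
theorem hasSum_integral_div_one_add {Ω : Type*} [MeasurableSpace Ω] {μ : Measure Ω}
    [IsFiniteMeasure μ] {W T : Ω → ℝ} (hW : Measurable W)
    (hT : Measurable T) (hWb : ∀ ω, |W ω| ≤ 1) (hT0 : ∀ ω, 0 ≤ T ω)
    (hT1 : ∀ ω, T ω ≤ 1) {x₀ x : ℝ} (hx₀ : -1 < x₀) (hx : |x - x₀| < 1 + x₀) :
    HasSum (fun i : ℕ => ∫ ω, (x - x₀) ^ i * (W ω * (-T ω) ^ i / (1 + x₀ * T ω) ^ (i + 1)) ∂μ)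
      (∫ ω, W ω / (1 + x * T ω) ∂μ) := by
  have h1 : 0 < 1 + x₀ := by linarith
  set d := min 1 (1 + x₀) with hd
  have hd0 : 0 < d := lt_min one_pos h1
  have hden : ∀ ω, d ≤ 1 + x₀ * T ω := fun ω => by
    have := min_le_left 1 (1 + x₀)
    have := min_le_right 1 (1 + x₀)
    nlinarith [hT0 ω, hT1 ω]
  have hquot : ∀ ω, T ω / (1 + x₀ * T ω) ≤ 1 / (1 + x₀) := fun ω => by
    rw [div_le_div_iff₀ (hd0.trans_le (hden ω)) h1]
    nlinarith [hT0 ω, hT1 ω]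
  set r := |x - x₀| / (1 + x₀) with hr
  have hr0 : 0 ≤ r := by positivity
  have hr1 : r < 1 := by rwa [hr, div_lt_one h1]
  have hrT : ∀ ω, |(x - x₀) * (-T ω) / (1 + x₀ * T ω)| ≤ r := fun ω => by
    rw [abs_div, abs_mul, abs_neg, abs_of_nonneg (hT0 ω),
      abs_of_pos (hd0.trans_le (hden ω)), mul_div_assoc, hr, div_eq_mul_one_div |x - x₀|]
    exact mul_le_mul_of_nonneg_left (hquot ω) (abs_nonneg _)
  -- The terms form a geometric series whose ratio is at most `r < 1` in absolute value, uniformly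
  -- in `ω`.
  have hform : ∀ i ω, (x - x₀) ^ i * (W ω * (-T ω) ^ i / (1 + x₀ * T ω) ^ (i + 1))
      = W ω / (1 + x₀ * T ω) * ((x - x₀) * (-T ω) / (1 + x₀ * T ω)) ^ i := fun i ω => by
    rw [div_pow, mul_pow, pow_succ]
    have := (hd0.trans_le (hden ω)).ne'
    field_simp
  refine hasSum_integral_of_dominated_convergence (fun i _ => 1 / d * r ^ i) (fun i => ?_)
    (fun i => .of_forall fun ω => ?_) (.of_forall fun ω => ?_) ?_ (.of_forall fun ω => ?_)
  · exact Measurable.aestronglyMeasurable (by fun_prop)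
  · rw [hform, Real.norm_eq_abs, abs_mul, abs_pow, abs_div, abs_of_pos (hd0.trans_le (hden ω))]
    gcongr
    · exact hWb ω
    · exact hden ω
    · exact hrT ω
  · exact (summable_geometric_of_lt_one hr0 hr1).mul_left _
  · exact integrable_const _
  · simp only [hform]
    have h := (hasSum_geometric_of_abs_lt_one ((hrT ω).trans_lt hr1)).mul_left
      (W ω / (1 + x₀ * T ω))
    have h2 := (hd0.trans_le (hden ω)).ne'
    have h3 : 1 - (x - x₀) * (-T ω) / (1 + x₀ * T ω) = (1 + x * T ω) / (1 + x₀ * T ω) := by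
      field_simp
      ring
    have h4 : W ω / (1 + x * T ω)
        = W ω / (1 + x₀ * T ω) * (1 - (x - x₀) * (-T ω) / (1 + x₀ * T ω))⁻¹ := by
      rw [h3, inv_div, div_mul_div_cancel₀ h2]
    rw [h4]
    exact h

theorem analyticAt_integral_div_one_add {Ω : Type*} [MeasurableSpace Ω] {μ : Measure Ω}
    [IsFiniteMeasure μ] {W T : Ω → ℝ} (hW : Measurable W)
    (hT : Measurable T) (hWb : ∀ ω, |W ω| ≤ 1) (hT0 : ∀ ω, 0 ≤ T ω)
    (hT1 : ∀ ω, T ω ≤ 1) {x₀ : ℝ} (hx₀ : -1 < x₀) :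
    AnalyticAt ℝ (fun x => ∫ ω, W ω / (1 + x * T ω) ∂μ) x₀ := by
  refine ⟨FormalMultilinearSeries.ofScalars ℝ
    (fun i : ℕ => ∫ ω, W ω * (-T ω) ^ i / (1 + x₀ * T ω) ^ (i + 1) ∂μ), ?_⟩
  rw [hasFPowerSeriesAt_iff]
  have hball : Metric.ball (0 : ℝ) (1 + x₀) ∈ 𝓝 (0 : ℝ) := Metric.ball_mem_nhds _ (by linarith)
  filter_upwards [hball] with z hz
  have h := hasSum_integral_div_one_add (μ := μ) hW hT hWb hT0 hT1 hx₀ (x := x₀ + z)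
    (by simpa using hz)
  simpa [integral_const_mul, FormalMultilinearSeries.coeff_ofScalars] using h

/-! ### Moments of the sine and Poisson's integral -/

/-- The measure `dθ` on `(0, π]`. -/
noncomputable def angleMeasure : Measure ℝ := volume.restrict (Set.Ioc 0 π)

instance : IsFiniteMeasure angleMeasure := by
  unfold angleMeasure; infer_instance

theorem integral_angleMeasure (g : ℝ → ℝ) :
    ∫ θ, g θ ∂angleMeasure = ∫ θ in (0 : ℝ)..π, g θ := by
  rw [intervalIntegral.integral_of_le Real.pi_pos.le, angleMeasure]

/-- `(1/2)_j / j!`. -/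
noncomputable def centralCoef (j : ℕ) : ℝ := poch (1 / 2) j / (Nat.factorial j : ℝ)

theorem poch_zero (a : ℝ) : poch a 0 = 1 := by simp [poch]

theorem poch_succ (a : ℝ) (n : ℕ) : poch a (n + 1) = poch a n * (a + n) := by
  simp [poch, ascPochhammer_succ_eval]

theorem poch_pos {a : ℝ} (ha : 0 < a) (n : ℕ) : 0 < poch a n := ascPochhammer_pos n a ha

theorem centralCoef_zero : centralCoef 0 = 1 := by simp [centralCoef, poch_zero]

theorem centralCoef_succ (j : ℕ) :
    centralCoef (j + 1) = centralCoef j * ((j + 1 / 2) / (j + 1)) := by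
  rw [centralCoef, centralCoef, poch_succ, Nat.factorial_succ]
  push_cast
  field_simp
  ring

theorem centralCoef_pos (j : ℕ) : 0 < centralCoef j :=
  div_pos (poch_pos (by norm_num) j) (by positivity)

theorem integral_angle_sin_pow_even (j : ℕ) :
    ∫ θ, Real.sin θ ^ (2 * j) ∂angleMeasure = π * centralCoef j := by
  rw [integral_angleMeasure]
  induction j with
  | zero => simp [centralCoef_zero]
  | succ j ih =>
    rw [mul_add, mul_one, integral_sin_pow, ih, centralCoef_succ]
    simp
    field_simp

/-- `j! / (1/2)_{j+1}`. -/
noncomputable def oddCoef (j : ℕ) : ℝ := (Nat.factorial j : ℝ) / poch (1 / 2) (j + 1)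

theorem oddCoef_succ (j : ℕ) : oddCoef (j + 1) = oddCoef j * ((j + 1) / (j + 3 / 2)) := by
  have := (poch_pos (show (0 : ℝ) < 1 / 2 by norm_num) (j + 1)).ne'
  rw [oddCoef, oddCoef, poch_succ _ (j + 1), Nat.factorial_succ]
  push_cast
  have h : (1 / 2 + ((j : ℝ) + 1)) = j + 3 / 2 := by ring
  rw [h]
  field_simp

theorem integral_angle_sin_pow_odd (j : ℕ) :
    ∫ θ, Real.sin θ ^ (2 * j + 1) ∂angleMeasure = oddCoef j := by
  rw [integral_angleMeasure]
  induction j with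
  | zero => simp [oddCoef, poch_succ, poch_zero]; norm_num
  | succ j ih =>
    rw [show 2 * (j + 1) + 1 = 2 * j + 1 + 2 by ring, integral_sin_pow, ih, oddCoef_succ]
    simp
    field_simp
    ring

/-- Poisson's integral `∫₀^π dθ / (1 + z sin² θ) = π / √(1 + z)`. -/
theorem integral_angle_inv_one_add_sin_sq {z : ℝ} (hz : -1 < z) :
    ∫ θ, 1 / (1 + z * Real.sin θ ^ 2) ∂angleMeasure = π / Real.sqrt (1 + z) := by
  rw [integral_angleMeasure]
  set a := Real.sqrt (1 + z) with ha
  have ha0 : 0 < a := Real.sqrt_pos.2 (by linarith)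
  have hz2 : z = a ^ 2 - 1 := by rw [ha, Real.sq_sqrt (by linarith)]; ring
  have hden : ∀ θ, 0 < 1 + z * Real.sin θ ^ 2 := fun θ =>
    one_add_mul_pos hz (sq_nonneg _) (Real.sin_sq_le_one θ)
  -- The antiderivative is `-arctan (cot θ / a) / a`. Using the cotangent keeps it smooth on all of
  -- `(0, π)`, so only the two endpoint limits are needed.
  have hcot0 : Tendsto (fun θ => a * Real.sin θ) (𝓝[>] 0) (𝓝[>] 0) := by
    refine tendsto_nhdsWithin_iff.2 ⟨?_, ?_⟩
    · have : Continuous fun θ => a * Real.sin θ := by fun_prop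
      simpa using (this.tendsto 0).mono_left nhdsWithin_le_nhds
    · filter_upwards [Ioo_mem_nhdsGT Real.pi_pos] with θ hθ
      exact mul_pos ha0 (Real.sin_pos_of_mem_Ioo hθ)
  have hcotπ : Tendsto (fun θ => a * Real.sin θ) (𝓝[<] π) (𝓝[>] 0) := by
    refine tendsto_nhdsWithin_iff.2 ⟨?_, ?_⟩
    · have : Continuous fun θ => a * Real.sin θ := by fun_prop
      simpa using (this.tendsto π).mono_left nhdsWithin_le_nhds
    · filter_upwards [Ioo_mem_nhdsLT Real.pi_pos] with θ hθ
      exact mul_pos ha0 (Real.sin_pos_of_mem_Ioo hθ)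
  have h0 : Tendsto (fun θ => -Real.arctan (Real.cos θ * (a * Real.sin θ)⁻¹) / a) (𝓝[>] 0)
      (𝓝 (-(π / 2) / a)) := by
    refine Tendsto.div_const (Tendsto.neg ?_) _
    refine (Real.tendsto_arctan_atTop.mono_right nhdsWithin_le_nhds).comp ?_
    exact (show Tendsto Real.cos (𝓝[>] 0) (𝓝 1) by
      simpa using (Real.continuous_cos.tendsto 0).mono_left nhdsWithin_le_nhds).pos_mul_atTop
      one_pos (tendsto_inv_nhdsGT_zero.comp hcot0)
  have hπ : Tendsto (fun θ => -Real.arctan (Real.cos θ * (a * Real.sin θ)⁻¹) / a) (𝓝[<] π)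
      (𝓝 (-(-(π / 2)) / a)) := by
    refine Tendsto.div_const (Tendsto.neg ?_) _
    refine (Real.tendsto_arctan_atBot.mono_right nhdsWithin_le_nhds).comp ?_
    exact (show Tendsto Real.cos (𝓝[<] π) (𝓝 (-1)) by
      simpa using (Real.continuous_cos.tendsto π).mono_left nhdsWithin_le_nhds).neg_mul_atTop
      (by norm_num) (tendsto_inv_nhdsGT_zero.comp hcotπ)
  have hderiv : ∀ θ ∈ Set.Ioo 0 π, HasDerivAt
      (fun θ => -Real.arctan (Real.cos θ * (a * Real.sin θ)⁻¹) / a)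
      (1 / (1 + z * Real.sin θ ^ 2)) θ := fun θ hθ => by
    have hs := Real.sin_pos_of_mem_Ioo hθ
    have h := ((((Real.hasDerivAt_cos θ).mul
      (((Real.hasDerivAt_sin θ).const_mul a).inv (mul_pos ha0 hs).ne')).arctan).neg).div_const a
    refine h.congr_deriv ?_
    have h1 := (hden θ).ne'
    have h2 : Real.cos θ ^ 2 = 1 - Real.sin θ ^ 2 := by
      linarith [Real.sin_sq_add_cos_sq θ]
    have h3 : 1 + z * Real.sin θ ^ 2 = a ^ 2 * Real.sin θ ^ 2 + Real.cos θ ^ 2 := by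
      rw [h2, hz2]; ring
    rw [h3] at h1 ⊢
    simp only [Pi.mul_apply, Pi.inv_apply]
    have h4 : 1 + (Real.cos θ * (a * Real.sin θ)⁻¹) ^ 2
        = (a ^ 2 * Real.sin θ ^ 2 + Real.cos θ ^ 2) / (a * Real.sin θ) ^ 2 := by
      field_simp
    rw [h4]
    field_simp
    linarith [Real.sin_sq_add_cos_sq θ]
  rw [intervalIntegral.integral_eq_sub_of_hasDerivAt_of_tendsto Real.pi_pos hderiv ?_ h0 hπ]
  · field_simp
    ring
  · exact (Continuous.intervalIntegrable
      (continuous_const.div (by fun_prop) fun θ => (hden θ).ne') _ _)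

/-! ### The power series of `s_n` -/

/-- The absolute value of the coefficient of `(-x) ^ (n + 1 + i)` in `s_n`. -/
noncomputable def sCoef (n i : ℕ) : ℝ := centralCoef (n + 1 + i) ^ 2 * oddCoef i

theorem centralCoef_mul_oddCoef (i : ℕ) :
    centralCoef (i + 1) * oddCoef i = 1 / ((i : ℝ) + 1) := by
  have := (poch_pos (show (0 : ℝ) < 1 / 2 by norm_num) (i + 1)).ne'
  rw [centralCoef, oddCoef, Nat.factorial_succ]
  push_cast
  field_simp

/-- Passing from `(n, i + 1)` to `(n + 1, i)` keeps `j = n + 1 + i` fixed and multiplies the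
quotient by `(i + 3/2) / (i + 1)`, exactly the ratio of `oddCoef i` to `oddCoef (i + 1)`. -/
theorem poch_div_poch_eq (n i : ℕ) :
    poch (1 / 2 - ((n + 1 + i : ℕ) : ℝ)) n /
        (((n + 1 + i : ℕ) : ℝ) * poch (1 - ((n + 1 + i : ℕ) : ℝ)) n)
      = centralCoef (n + 1 + i) * oddCoef i := by
  induction n generalizing i with
  | zero =>
    rw [poch_zero, poch_zero, zero_add, add_comm 1 i, centralCoef_mul_oddCoef]
    push_cast
    ring
  | succ n ih =>
    have h := ih (i + 1)
    rw [show n + 1 + (i + 1) = n + 1 + 1 + i by ring] at h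
    rw [poch_succ, poch_succ]
    have h1 : (1 / 2 - ((n + 1 + 1 + i : ℕ) : ℝ) + n) = -(i + 3 / 2) := by push_cast; ring
    have h2 : (1 - ((n + 1 + 1 + i : ℕ) : ℝ) + n) = -(i + 1) := by push_cast; ring
    rw [h1, h2, ← mul_assoc, mul_div_mul_comm, h, oddCoef_succ]
    have h3 : (i : ℝ) + 1 ≠ 0 := by positivity
    have h4 : (i : ℝ) + 3 / 2 ≠ 0 := by positivity
    field_simp

theorem sTerm_eq (n i : ℕ) (x : ℝ) :
    sTerm n x (n + 1 + i) = sCoef n i * (-x) ^ (n + 1 + i) := by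
  rw [sTerm, sCoef, mul_assoc (Nat.factorial _ : ℝ), mul_div_mul_comm, poch_div_poch_eq,
    ← centralCoef]
  ring

theorem centralCoef_le_one (j : ℕ) : centralCoef j ≤ 1 := by
  induction j with
  | zero => rw [centralCoef_zero]
  | succ j ih =>
    rw [centralCoef_succ]
    refine mul_le_one₀ ih (by positivity) ?_
    rw [div_le_one (by positivity)]
    linarith

/-- Poisson's integral with its integrand expanded in powers of `x`: the binomial series comes from
the even sine moments. -/
theorem hasSum_inv_sqrt {x : ℝ} (hx : |x| < 1) :
    HasSum (fun j : ℕ => centralCoef j * (-x) ^ j) (1 / Real.sqrt (1 + x)) := by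
  have h := hasSum_integral_div_one_add (μ := angleMeasure) (W := fun _ => 1)
    (T := fun θ => Real.sin θ ^ 2) (by fun_prop) (by fun_prop) (by simp)
    (fun θ => sq_nonneg _) (fun θ => Real.sin_sq_le_one θ) (x₀ := 0) (x := x) (by norm_num)
    (by simpa using hx)
  rw [integral_angle_inv_one_add_sin_sq (abs_lt.1 hx).1] at h
  have h' := h.div_const π
  have hπ := Real.pi_pos.ne'
  convert! h' using 1
  · funext j
    have : ∀ θ : ℝ, (x - 0) ^ j * (1 * (-Real.sin θ ^ 2) ^ j / (1 + 0 * Real.sin θ ^ 2) ^ (j + 1))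
        = (-x) ^ j * Real.sin θ ^ (2 * j) := fun θ => by
      rw [pow_mul, neg_pow x, neg_pow (Real.sin θ ^ 2)]
      simp
      ring
    simp only [this]
    rw [integral_const_mul, integral_angle_sin_pow_even]
    field_simp
  · field_simp

/-- Integrate `(1 / √(1 + x t) - 1) / t` over `t ∈ [0, 1]`, termwise on one side. In closed form the
integrand is `-x / (r (1 + r))` with `r = √(1 + x t)`, the derivative of `-2 log ((1 + r) / 2)`. -/
theorem hasSum_log {x : ℝ} (hx : |x| < 1) :
    HasSum (fun i : ℕ => centralCoef (i + 1) / (i + 1) * (-x) ^ (i + 1))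
      (-2 * Real.log ((1 + Real.sqrt (1 + x)) / 2)) := by
  have hpos : ∀ t ∈ Set.uIcc (0 : ℝ) 1, 0 < 1 + x * t := fun t ht => by
    rw [Set.uIcc_of_le zero_le_one] at ht
    exact one_add_mul_pos (abs_lt.1 hx).1 ht.1 ht.2
  have hsqrt : ∀ t ∈ Set.uIcc (0 : ℝ) 1, 0 < Real.sqrt (1 + x * t) :=
    fun t ht => Real.sqrt_pos.2 (hpos t ht)
  have hint : ∫ t in (0 : ℝ)..1, -x / (Real.sqrt (1 + x * t) * (1 + Real.sqrt (1 + x * t)))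
      = -2 * Real.log ((1 + Real.sqrt (1 + x)) / 2) := by
    rw [intervalIntegral.integral_eq_sub_of_hasDerivAt
      (f := fun t => -2 * Real.log ((1 + Real.sqrt (1 + x * t)) / 2))]
    · norm_num
    · intro t ht
      have h1 := hsqrt t ht
      have h := ((((((hasDerivAt_id t).const_mul x).const_add 1).sqrt
        (hpos t ht).ne').const_add 1).div_const 2).log (by simp only [id]; positivity)
      refine (h.const_mul (-2)).congr_deriv ?_
      simp only [id]
      field_simp
    · refine ContinuousOn.intervalIntegrable ?_
      refine ContinuousOn.div (by fun_prop) (by fun_prop) fun t ht => ?_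
      have := hsqrt t ht
      positivity
  rw [← hint]
  have hterm : ∀ i : ℕ, centralCoef (i + 1) / (i + 1) * (-x) ^ (i + 1)
      = ∫ t in (0 : ℝ)..1, centralCoef (i + 1) * (-x) ^ (i + 1) * t ^ i := fun i => by
    rw [intervalIntegral.integral_const_mul, integral_pow]
    simp
    ring
  simp only [hterm]
  refine intervalIntegral.hasSum_integral_of_dominated_convergence
    (fun i _ => |x| ^ (i + 1)) (fun i => Continuous.aestronglyMeasurable (by fun_prop))
    (fun i => .of_forall fun t ht => ?_) (.of_forall fun t _ => ?_) (by simp)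
    (.of_forall fun t ht => ?_)
  · rw [Set.uIoc_of_le zero_le_one] at ht
    rw [Real.norm_eq_abs, abs_mul, abs_mul, abs_pow, abs_neg, abs_of_pos (centralCoef_pos _),
      abs_pow, abs_of_pos ht.1]
    calc _ ≤ 1 * |x| ^ (i + 1) * 1 := by
          gcongr
          · exact pow_nonneg ht.1.le i
          · exact centralCoef_le_one _
          · exact pow_le_one₀ ht.1.le ht.2
      _ = _ := by ring
  · exact (summable_nat_add_iff 1).2 (summable_geometric_of_lt_one (abs_nonneg x) hx)
  · have ht' := Set.uIoc_subset_uIcc ht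
    rw [Set.uIoc_of_le zero_le_one] at ht
    have h := (hasSum_nat_add_iff' 1).2 (hasSum_inv_sqrt (x := x * t) (by
      rw [abs_mul, abs_of_pos ht.1]
      exact (mul_le_of_le_one_right (abs_nonneg x) ht.2).trans_lt hx))
    have h' := h.div_const t
    have ht0 := ht.1.ne'
    have h1 := hsqrt t ht'
    convert! h' using 1
    · funext i
      rw [neg_mul_eq_neg_mul, mul_pow, pow_succ t]
      field_simp
    · simp only [Finset.range_one, Finset.sum_singleton, pow_zero, centralCoef_zero, mul_one]
      have h2 := Real.sq_sqrt (hpos t ht').le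
      field_simp
      linarith

theorem sCoef_zero (i : ℕ) : sCoef 0 i = centralCoef (i + 1) / (i + 1) := by
  rw [sCoef, zero_add, add_comm 1 i, sq, mul_assoc, centralCoef_mul_oddCoef]
  ring

theorem hasSum_s_zero {x : ℝ} (hx : |x| < 1) :
    HasSum (fun i : ℕ => sCoef 0 i * (-x) ^ (0 + 1 + i)) (s 0 x) := by
  simpa [sCoef_zero, s, add_comm] using hasSum_log hx

theorem hasSum_s_one {x : ℝ} (hx : |x| < 1) :
    HasSum (fun i : ℕ => sCoef 1 i * (-x) ^ (1 + 1 + i)) (s 1 x) := by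
  have hx1 : 0 < 1 + x := by linarith [(abs_lt.1 hx).1]
  have hr := Real.sqrt_pos.2 hx1
  have L := hasSum_log hx
  have G := hasSum_inv_sqrt hx
  have L1 := (hasSum_nat_add_iff' 1).2 L
  have G1 := (hasSum_nat_add_iff' 1).2 G
  have G2 := (hasSum_nat_add_iff' 2).2 G
  -- The weights are read off `s 1`: `-2 (1/2 - x/4)` is its coefficient of the logarithm, and `-(1
  -- + x)/2` comes from writing `√(1 + x) = (1 + x) / √(1 + x)`. The shifts make every series start
  -- at `x²`; the dropped terms give the polynomial part.
  have h := (((L1.mul_left (1 / 2)).add (L.mul_left (-x / 4))).add (G2.mul_left (-1 / 2))).add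
    (G1.mul_left (-x / 2))
  convert! h using 1
  · funext i
    have e1 : sCoef 1 i = centralCoef (i + 2) ^ 2 * oddCoef i := by
      rw [sCoef, show 1 + 1 + i = i + 2 by ring]
    have e2 := centralCoef_mul_oddCoef i
    have e3 : oddCoef i = 1 / ((i : ℝ) + 1) / centralCoef (i + 1) := by
      have := (centralCoef_pos (i + 1)).ne'
      field_simp at e2 ⊢
      linarith
    have e4 := centralCoef_succ (i + 1)
    have := (centralCoef_pos (i + 1)).ne'
    rw [e1, e3]
    simp only [show i + 1 + 1 = i + 2 by ring] at e4 ⊢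
    rw [e4]
    push_cast
    rw [show 1 + 1 + i = i + 2 by ring, show i + 2 = i + 1 + 1 by ring, pow_succ]
    field_simp
    ring
  · simp only [s, Finset.sum_range_succ, Finset.range_zero, Finset.sum_empty, centralCoef_succ,
      centralCoef_zero]
    generalize Real.log ((1 + Real.sqrt (1 + x)) / 2) = l
    have hq : Real.sqrt (1 + x) = (1 + x) * (1 / Real.sqrt (1 + x)) := by
      field_simp
      exact Real.sq_sqrt hx1.le
    generalize 1 / Real.sqrt (1 + x) = q at hq ⊢
    rw [hq]
    push_cast
    ring

theorem hasSum_s_two {x : ℝ} (hx : |x| < 1) :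
    HasSum (fun i : ℕ => sCoef 2 i * (-x) ^ (2 + 1 + i)) (s 2 x) := by
  have hx1 : 0 < 1 + x := by linarith [(abs_lt.1 hx).1]
  have hr := Real.sqrt_pos.2 hx1
  have L := hasSum_log hx
  have G := hasSum_inv_sqrt hx
  have L1 := (hasSum_nat_add_iff' 1).2 L
  have L2 := (hasSum_nat_add_iff' 2).2 L
  have G1 := (hasSum_nat_add_iff' 1).2 G
  have G2 := (hasSum_nat_add_iff' 2).2 G
  have G3 := (hasSum_nat_add_iff' 3).2 G
  -- As for `s 1`: the logarithm has weight `-2 (3/8 - x/8 + 9x²/64)`, and the `G` weights sum to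
  -- `(1 + x) (9x/32 - 7/16)`. All series now start at `x³`.
  have h := (((((L2.mul_left (3 / 8)).add (L1.mul_left (-x / 8))).add
    (L.mul_left (9 / 64 * x ^ 2))).add (G3.mul_left (-7 / 16))).add
    (G2.mul_left (-(5 / 32) * x))).add (G1.mul_left (9 / 32 * x ^ 2))
  convert! h using 1
  · funext i
    have e1 : sCoef 2 i = centralCoef (i + 3) ^ 2 * oddCoef i := by
      rw [sCoef, show 2 + 1 + i = i + 3 by ring]
    have e2 := centralCoef_mul_oddCoef i
    have e3 : oddCoef i = 1 / ((i : ℝ) + 1) / centralCoef (i + 1) := by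
      have := (centralCoef_pos (i + 1)).ne'
      field_simp at e2 ⊢
      linarith
    have e4 := centralCoef_succ (i + 1)
    have e5 := centralCoef_succ (i + 2)
    have := (centralCoef_pos (i + 1)).ne'
    rw [e1, e3]
    simp only [show i + 1 + 1 = i + 2 by ring, show i + 2 + 1 = i + 3 by ring] at e4 e5 ⊢
    rw [e5, e4]
    push_cast
    rw [show 2 + 1 + i = i + 3 by ring, show i + 3 = i + 1 + 1 + 1 by ring,
      show i + 2 = i + 1 + 1 by ring, pow_succ, pow_succ]
    field_simp
    ring
  · simp only [s, Finset.sum_range_succ, Finset.range_zero, Finset.sum_empty, centralCoef_succ,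
      centralCoef_zero]
    generalize Real.log ((1 + Real.sqrt (1 + x)) / 2) = l
    have hq : Real.sqrt (1 + x) = (1 + x) * (1 / Real.sqrt (1 + x)) := by
      field_simp
      exact Real.sq_sqrt hx1.le
    generalize 1 / Real.sqrt (1 + x) = q at hq ⊢
    rw [hq]
    push_cast
    ring

theorem centralCoef_eq_poch (n : ℕ) :
    centralCoef (n + 1) = poch (3 / 2) n / (2 * (Nat.factorial (n + 1) : ℝ)) := by
  induction n with
  | zero => simp [centralCoef_succ, centralCoef_zero, poch_zero]
  | succ n ih =>
    rw [centralCoef_succ, ih, poch_succ, Nat.factorial_succ (n + 1)]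
    push_cast
    field_simp
    ring

/-- The power series of `s_n` satisfy the recurrence. -/
theorem hasSum_s_step {n : ℕ} {x : ℝ}
    (h0 : HasSum (fun i : ℕ => sCoef n i * (-x) ^ (n + 1 + i)) (s n x))
    (h1 : HasSum (fun i : ℕ => sCoef (n + 1) i * (-x) ^ (n + 1 + 1 + i)) (s (n + 1) x))
    (h2 : HasSum (fun i : ℕ => sCoef (n + 2) i * (-x) ^ (n + 2 + 1 + i)) (s (n + 2) x)) :
    HasSum (fun i : ℕ => sCoef (n + 3) i * (-x) ^ (n + 3 + 1 + i)) (s (n + 3) x) := by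
  -- The shifts, together with the factors `x` in the recurrence, make all series start at
  -- `x^(n+4)`. The dropped low-order terms are cancelled by `termH`.
  have h01 := (hasSum_nat_add_iff' 2).2 h0
  have h11 := (hasSum_nat_add_iff' 1).2 h1
  have h12 := (hasSum_nat_add_iff' 2).2 h1
  have h21 := (hasSum_nat_add_iff' 1).2 h2
  have h := ((((h21.mul_left (8 * (n : ℝ) ^ 2 + 36 * n + 42)).add
    (h2.mul_left (-x * (2 * n + 5) ^ 2))).add
    (h11.mul_left (2 * x * (4 * (n : ℝ) ^ 2 + 14 * n + 13)))).add
    (h12.mul_left (-(2 * (n : ℝ) + 3) ^ 2))).add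
    (h01.mul_left (-4 * x * ((n : ℝ) + 1) ^ 2))
  have h' := h.div_const (4 * ((n : ℝ) + 3) ^ 2)
  have c2 : centralCoef (n + 2) = centralCoef (n + 1) * ((n + 3 / 2) / (n + 2)) := by
    rw [centralCoef_succ]; push_cast; ring
  have c3 : centralCoef (n + 3) = centralCoef (n + 2) * ((n + 5 / 2) / (n + 3)) := by
    rw [centralCoef_succ]; push_cast; ring
  convert! h' using 1
  · funext i
    have i3 : sCoef (n + 3) i = centralCoef (n + i + 4) ^ 2 * oddCoef i := by
      rw [sCoef, show n + 3 + 1 + i = n + i + 4 by ring]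
    have i21 : sCoef (n + 2) (i + 1) = centralCoef (n + i + 4) ^ 2 * oddCoef (i + 1) := by
      rw [sCoef, show n + 2 + 1 + (i + 1) = n + i + 4 by ring]
    have i2 : sCoef (n + 2) i = centralCoef (n + i + 3) ^ 2 * oddCoef i := by
      rw [sCoef, show n + 2 + 1 + i = n + i + 3 by ring]
    have i11 : sCoef (n + 1) (i + 1) = centralCoef (n + i + 3) ^ 2 * oddCoef (i + 1) := by
      rw [sCoef, show n + 1 + 1 + (i + 1) = n + i + 3 by ring]
    have i12 : sCoef (n + 1) (i + 2) = centralCoef (n + i + 4) ^ 2 * oddCoef (i + 2) := by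
      rw [sCoef, show n + 1 + 1 + (i + 2) = n + i + 4 by ring]
    have i01 : sCoef n (i + 2) = centralCoef (n + i + 3) ^ 2 * oddCoef (i + 2) := by
      rw [sCoef, show n + 1 + (i + 2) = n + i + 3 by ring]
    have cc : centralCoef (n + i + 4) = centralCoef (n + i + 3) * ((n + i + 7 / 2) / (n + i + 4)) := by
      rw [centralCoef_succ]; push_cast; ring
    have o1 := oddCoef_succ i
    have o2 : oddCoef (i + 2) = oddCoef (i + 1) * ((i + 2) / (i + 5 / 2)) := by
      rw [oddCoef_succ]; push_cast; ring
    rw [i3, i21, i2, i11, i12, i01, cc, o2, o1]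
    rw [show n + 3 + 1 + i = n + i + 3 + 1 by ring, show n + 2 + 1 + (i + 1) = n + i + 3 + 1 by ring,
      show n + 2 + 1 + i = n + i + 3 by ring, show n + 1 + 1 + (i + 1) = n + i + 3 by ring,
      show n + 1 + 1 + (i + 2) = n + i + 3 + 1 by ring, show n + 1 + (i + 2) = n + i + 3 by ring,
      pow_succ]
    have d1 : (i : ℝ) + 3 / 2 ≠ 0 := by positivity
    have d2 : (i : ℝ) + 5 / 2 ≠ 0 := by positivity
    have d3 : (n : ℝ) + i + 4 ≠ 0 := by positivity
    have d4 : (n : ℝ) + 3 ≠ 0 := by positivity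
    field_simp
    ring
  · rw [s]
    congr 1
    have hH : termH n x = (x * (2 * (n : ℝ) + 5) * (2 * n + 3) ^ 2
        + (n + 3) * (8 * n ^ 2 + 24 * n + 17)) / (2 * (n + 3) * (n + 2) ^ 2)
        * centralCoef (n + 1) ^ 2 * (-x) ^ (n + 2) := by
      rw [termH, centralCoef_eq_poch, Nat.factorial_succ (n + 1)]
      push_cast
      field_simp
      ring
    have o0 : oddCoef 0 = 2 := by simp [oddCoef, poch_succ, poch_zero]
    have o1 : oddCoef 1 = 4 / 3 := by rw [oddCoef_succ, o0]; norm_num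
    simp only [Finset.sum_range_succ, Finset.range_zero, Finset.sum_empty, coefA, coefB, coefC, hH,
      sCoef, o0, o1, add_zero, zero_add]
    simp only [show n + 2 + 1 = n + 3 by ring, show n + 1 + 1 = n + 2 by ring,
      c3, c2]
    rw [show n + 3 = n + 1 + 1 + 1 by ring, show n + 2 = n + 1 + 1 by ring, pow_succ, pow_succ]
    have d1 : (n : ℝ) + 2 ≠ 0 := by positivity
    have d4 : (n : ℝ) + 3 ≠ 0 := by positivity
    field_simp
    ring

theorem hasSum_s {x : ℝ} (hx : |x| < 1) (n : ℕ) :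
    HasSum (fun i : ℕ => sCoef n i * (-x) ^ (n + 1 + i)) (s n x) := by
  induction n using Nat.strong_induction_on with
  | _ n ih =>
    match n, ih with
    | 0, _ => exact hasSum_s_zero hx
    | 1, _ => exact hasSum_s_one hx
    | 2, _ => exact hasSum_s_two hx
    | n + 3, ih =>
      exact hasSum_s_step (ih n (by omega)) (ih (n + 1) (by omega)) (ih (n + 2) (by omega))

/-! ### The integral for `s_n` and analytic continuation -/

/-- `sin² θ sin² φ`. -/
noncomputable def sinSqProd (p : ℝ × ℝ) : ℝ := Real.sin p.1 ^ 2 * Real.sin p.2 ^ 2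

/-- The measure `dθ dφ` on `(0, π]²`. -/
noncomputable def pairMeasure : Measure (ℝ × ℝ) := angleMeasure.prod angleMeasure

instance : IsFiniteMeasure pairMeasure := by
  unfold pairMeasure; infer_instance

theorem continuous_sinSqProd : Continuous sinSqProd := by
  unfold sinSqProd; fun_prop

theorem sinSqProd_nonneg (p : ℝ × ℝ) : 0 ≤ sinSqProd p := by
  unfold sinSqProd; positivity

theorem sinSqProd_le_one (p : ℝ × ℝ) : sinSqProd p ≤ 1 :=
  mul_le_one₀ (Real.sin_sq_le_one _) (sq_nonneg _) (Real.sin_sq_le_one _)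

theorem integral_sinSqProd_pow (j : ℕ) :
    ∫ p, sinSqProd p ^ j ∂pairMeasure = π ^ 2 * centralCoef j ^ 2 := by
  have h : ∀ p : ℝ × ℝ, sinSqProd p ^ j = Real.sin p.1 ^ (2 * j) * Real.sin p.2 ^ (2 * j) :=
    fun p => by rw [sinSqProd, mul_pow, pow_mul, pow_mul]
  simp only [h]
  rw [pairMeasure, integral_prod_mul (fun θ => Real.sin θ ^ (2 * j)) fun θ => Real.sin θ ^ (2 * j),
    integral_angle_sin_pow_even]
  ring

/-- The Stieltjes integral representing `s_n`. -/
noncomputable def sInt (n : ℕ) (x : ℝ) : ℝ :=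
  ∫ ω, sinSqProd ω.2 ^ (n + 1) * Real.sin ω.1 / (1 + x * (sinSqProd ω.2 * Real.sin ω.1 ^ 2))
    ∂angleMeasure.prod pairMeasure

theorem abs_sinSqProd_pow_mul_sin_le (n : ℕ) (ω : ℝ × ℝ × ℝ) :
    |sinSqProd ω.2 ^ (n + 1) * Real.sin ω.1| ≤ 1 := by
  rw [abs_mul, abs_pow, abs_of_nonneg (sinSqProd_nonneg _)]
  exact mul_le_one₀ (pow_le_one₀ (sinSqProd_nonneg _) (sinSqProd_le_one _)) (abs_nonneg _)
    (Real.abs_sin_le_one _)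

theorem sInt_analyticAt (n : ℕ) {x : ℝ} (hx : -1 < x) : AnalyticAt ℝ (sInt n) x := by
  have hc := continuous_sinSqProd.measurable
  exact analyticAt_integral_div_one_add (by fun_prop) (by fun_prop)
    (abs_sinSqProd_pow_mul_sin_le n)
    (fun ω => mul_nonneg (sinSqProd_nonneg _) (sq_nonneg _))
    (fun ω => mul_le_one₀ (sinSqProd_le_one _) (sq_nonneg _) (Real.sin_sq_le_one _)) hx

/-- In the termwise expansion the `i`-th integral factors into an odd sine moment, `oddCoef i`, and
a moment of `sinSqProd`, `π²` times the square of `centralCoef (n + 1 + i)`. -/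
theorem hasSum_sInt (n : ℕ) {x : ℝ} (hx : |x| < 1) :
    HasSum (fun i : ℕ => sCoef n i * (-x) ^ (n + 1 + i)) ((-x) ^ (n + 1) / π ^ 2 * sInt n x) := by
  have hc := continuous_sinSqProd.measurable
  have h := hasSum_integral_div_one_add (μ := angleMeasure.prod pairMeasure)
    (W := fun ω => sinSqProd ω.2 ^ (n + 1) * Real.sin ω.1)
    (T := fun ω => sinSqProd ω.2 * Real.sin ω.1 ^ 2) (by fun_prop) (by fun_prop)
    (abs_sinSqProd_pow_mul_sin_le n)
    (fun ω => mul_nonneg (sinSqProd_nonneg _) (sq_nonneg _))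
    (fun ω => mul_le_one₀ (sinSqProd_le_one _) (sq_nonneg _) (Real.sin_sq_le_one _))
    (x₀ := 0) (x := x) (by norm_num) (by simpa using hx)
  have h' := h.mul_left ((-x) ^ (n + 1) / π ^ 2)
  have hπ := Real.pi_pos.ne'
  convert! h' using 1
  funext i
  have e : ∀ ω : ℝ × ℝ × ℝ, (x - 0) ^ i * (sinSqProd ω.2 ^ (n + 1) * Real.sin ω.1 *
        (-(sinSqProd ω.2 * Real.sin ω.1 ^ 2)) ^ i /
          (1 + 0 * (sinSqProd ω.2 * Real.sin ω.1 ^ 2)) ^ (i + 1))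
      = (-x) ^ i * (Real.sin ω.1 ^ (2 * i + 1) * sinSqProd ω.2 ^ (n + 1 + i)) := fun ω => by
    rw [neg_pow x, neg_pow (sinSqProd ω.2 * _), mul_pow]
    simp
    ring
  simp only [e]
  rw [integral_const_mul, integral_prod_mul (fun θ => Real.sin θ ^ (2 * i + 1))
    (fun p => sinSqProd p ^ (n + 1 + i)), integral_angle_sin_pow_odd, integral_sinSqProd_pow, sCoef]
  field_simp
  ring

theorem s_analyticAt {x : ℝ} (hx : -1 < x) (n : ℕ) : AnalyticAt ℝ (s n) x := by
  have hx1 : 0 < 1 + x := by linarith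
  have hsqrt : AnalyticAt ℝ (fun x : ℝ => Real.sqrt (1 + x)) x :=
    ContDiffAt.analyticAt ((contDiffAt_const.add contDiffAt_id).sqrt hx1.ne')
  have hr := Real.sqrt_pos.2 hx1
  have hlog : AnalyticAt ℝ (fun x : ℝ => Real.log ((1 + Real.sqrt (1 + x)) / 2)) x :=
    AnalyticAt.log (by fun_prop) (by positivity)
  induction n using Nat.strong_induction_on with
  | _ n ih =>
    match n, ih with
    | 0, _ =>
      have h : AnalyticAt ℝ (fun x : ℝ => -2 * Real.log ((1 + Real.sqrt (1 + x)) / 2)) x := by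
        fun_prop
      exact h.congr (.of_forall fun y => by rw [s])
    | 1, _ =>
      have h : AnalyticAt ℝ (fun x : ℝ => (x / 2 - 1) * Real.log ((1 + Real.sqrt (1 + x)) / 2)
        - 1 / 2 * Real.sqrt (1 + x) + 1 / 2 + x / 2) x := by fun_prop
      exact h.congr (.of_forall fun y => by rw [s])
    | 2, _ =>
      have h : AnalyticAt ℝ (fun x : ℝ => (-(9 / 32) * x ^ 2 + x / 4 - 3 / 4) *
        Real.log ((1 + Real.sqrt (1 + x)) / 2)
        + (9 / 32 * x - 7 / 16) * Real.sqrt (1 + x) + 7 / 16 + 1 / 8 * x - 21 / 64 * x ^ 2) x := by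
        fun_prop
      exact h.congr (.of_forall fun y => by rw [s])
    | n + 3, ih =>
      have h0 := ih n (by omega)
      have h1 := ih (n + 1) (by omega)
      have h2 := ih (n + 2) (by omega)
      have h : AnalyticAt ℝ (fun x : ℝ => (coefA n x * s (n + 2) x + coefB n x * s (n + 1) x +
          coefC n x * s n x + termH n x) / (4 * ((n : ℝ) + 3) ^ 2)) x := by
        have hA : AnalyticAt ℝ (coefA n) x := by unfold coefA; fun_prop
        have hB : AnalyticAt ℝ (coefB n) x := by unfold coefB; fun_prop
        have hC : AnalyticAt ℝ (coefC n) x := by unfold coefC; fun_prop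
        have hH : AnalyticAt ℝ (termH n) x := by
          unfold termH
          simp only [div_eq_mul_inv]
          fun_prop
        simp only [div_eq_mul_inv]
        fun_prop
      exact h.congr (.of_forall fun y => by rw [s])

/-- Identity theorem on `(-1, ∞)`, starting from the common power series at `0`. The range beyond
the unit disc is essential: `(1 - k²) lam² / (1 - lam²)` can be arbitrarily large. -/
theorem s_eq_sInt {x : ℝ} (hx : -1 < x) (n : ℕ) : s n x = (-x) ^ (n + 1) / π ^ 2 * sInt n x := by
  have hS : AnalyticOnNhd ℝ (fun x => (-x) ^ (n + 1) / π ^ 2 * sInt n x) (Set.Ioi (-1)) :=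
    fun y hy => by
      have h1 := sInt_analyticAt n hy
      have h2 : AnalyticAt ℝ (fun x : ℝ => (-x) ^ (n + 1) / π ^ 2) y := by
        simp only [div_eq_mul_inv]
        fun_prop
      exact h2.mul h1
  refine AnalyticOnNhd.eqOn_of_preconnected_of_eventuallyEq (fun y hy => s_analyticAt hy n) hS
    isPreconnected_Ioi (z₀ := 0) (Set.mem_Ioi.2 (by norm_num)) ?_ hx
  filter_upwards [Metric.ball_mem_nhds (0 : ℝ) one_pos] with y hy
  have hy' : |y| < 1 := by simpa using hy
  exact (hasSum_s hy' n).unique (hasSum_sInt n hy')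

/-! ### The elliptic integral as a triple integral -/

theorem integrable_restrict_prod_of_continuousOn {a b : ℝ} {g : ℝ × ℝ → ℝ}
    (hg : ContinuousOn g (Set.Icc 0 a ×ˢ Set.Icc 0 b)) :
    Integrable g ((volume.restrict (Set.Ioc 0 a)).prod (volume.restrict (Set.Ioc 0 b))) := by
  rw [Measure.prod_restrict]
  exact (hg.integrableOn_compact (isCompact_Icc.prod isCompact_Icc)).mono_set
    (Set.prod_mono Set.Ioc_subset_Icc_self Set.Ioc_subset_Icc_self)

theorem integrable_angle_of_continuous {g : ℝ → ℝ} (hg : Continuous g) :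
    Integrable g angleMeasure := hg.integrableOn_Ioc

theorem integrable_pair_of_continuous {g : ℝ × ℝ → ℝ} (hg : Continuous g) :
    Integrable g pairMeasure := integrable_restrict_prod_of_continuousOn hg.continuousOn

theorem integrable_triple_of_continuous {g : ℝ × ℝ × ℝ → ℝ} (hg : Continuous g) :
    Integrable g (angleMeasure.prod pairMeasure) := by
  rw [pairMeasure, angleMeasure, Measure.prod_restrict, Measure.prod_restrict]
  exact (hg.continuousOn.integrableOn_compact
    (isCompact_Icc.prod (isCompact_Icc.prod isCompact_Icc))).mono_set
    (Set.prod_mono Set.Ioc_subset_Icc_self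
      (Set.prod_mono Set.Ioc_subset_Icc_self Set.Ioc_subset_Icc_self))

/-- Since `1 + z sin² θ = z (S² - cos² θ)`, the variable `cos θ` turns this into a rational integral
with a logarithmic antiderivative. -/
theorem integral_angle_sin_div_one_add {z : ℝ} (hz : 0 < z) {S : ℝ}
    (hS : S = Real.sqrt (1 + 1 / z)) :
    ∫ θ, Real.sin θ / (1 + z * Real.sin θ ^ 2) ∂angleMeasure
      = 1 / (z * S) * Real.log ((S + 1) / (S - 1)) := by
  rw [integral_angleMeasure]
  have hS1 : 1 < S := by
    rw [hS]
    exact Real.lt_sqrt_of_sq_lt (by have : 0 < 1 / z := by positivity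
                                    linarith)
  have hS2 : z * S ^ 2 = z + 1 := by
    rw [hS, Real.sq_sqrt (by positivity)]
    field_simp
  have hden : ∀ θ : ℝ, 0 < 1 + z * Real.sin θ ^ 2 := fun θ => by positivity
  rw [intervalIntegral.integral_eq_sub_of_hasDerivAt (f := fun θ => 1 / (2 * z * S) *
    (Real.log (S - Real.cos θ) - Real.log (S + Real.cos θ)))]
  · rw [Real.log_div (by linarith) (by linarith)]
    simp only [Real.cos_pi, Real.cos_zero, sub_neg_eq_add, ← sub_eq_add_neg]
    field_simp
    ring
  · intro θ _
    have h1 : 0 < S - Real.cos θ := by linarith [Real.cos_le_one θ]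
    have h2 : 0 < S + Real.cos θ := by linarith [Real.neg_one_le_cos θ]
    have h := ((((Real.hasDerivAt_cos θ).const_sub S).log h1.ne').sub
      (((Real.hasDerivAt_cos θ).const_add S).log h2.ne')).const_mul (1 / (2 * z * S))
    refine h.congr_deriv ?_
    have h3 : 1 + z * Real.sin θ ^ 2 = z * ((S - Real.cos θ) * (S + Real.cos θ)) := by
      rw [Real.sin_sq]
      linarith
    rw [h3]
    field_simp
    ring
  · exact (Continuous.intervalIntegrable
      (Real.continuous_sin.div (by fun_prop) fun θ => (hden θ).ne') _ _)

theorem integral_symm_of_even {g : ℝ → ℝ} {a : ℝ} (ha : 0 ≤ a)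
    (hg : ContinuousOn g (Set.Icc (-a) a)) (he : ∀ t, g (-t) = g t) :
    ∫ t in (-a)..a, g t = 2 * ∫ t in (0 : ℝ)..a, g t := by
  have h : ∫ t in (-a)..0, g t = ∫ t in (0 : ℝ)..a, g t := by
    have := intervalIntegral.integral_comp_neg (a := 0) (b := a) g
    simp only [he, neg_zero] at this
    exact this.symm
  rw [← intervalIntegral.integral_add_adjacent_intervals (b := 0), h]
  · ring
  · refine ContinuousOn.intervalIntegrable (hg.mono ?_)
    rw [Set.uIcc_of_le (by linarith)]
    exact Set.Icc_subset_Icc_right ha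
  · refine ContinuousOn.intervalIntegrable (hg.mono ?_)
    rw [Set.uIcc_of_le ha]
    exact Set.Icc_subset_Icc_left (by linarith)

theorem integral_angle_sin_div_sqrt {lam U κ : ℝ} (hlam : lam ∈ Set.Ioo (0 : ℝ) 1)
    (hU : U = lam ^ 2 / (1 - lam ^ 2)) (hκ : 0 ≤ κ) :
    U / lam * ∫ ψ, Real.sin ψ / ((1 + U * Real.sin ψ ^ 2) *
        Real.sqrt (1 + κ * (U * Real.sin ψ ^ 2))) ∂angleMeasure
      = 2 * ∫ t in (0 : ℝ)..lam, 1 / (1 - (1 - κ) * t ^ 2) := by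
  obtain ⟨hl0, hl1⟩ := hlam
  have hl2 : 0 < 1 - lam ^ 2 := by nlinarith
  have hU0 : 0 < U := by rw [hU]; positivity
  have hUl : U * (1 - lam ^ 2) = lam ^ 2 := by rw [hU]; field_simp
  have hD : ∀ ψ : ℝ, 0 < 1 + κ * (U * Real.sin ψ ^ 2) := fun ψ => by positivity
  have hg : ∀ t ∈ Set.Icc (-lam) lam, 0 < 1 - (1 - κ) * t ^ 2 := fun t ht => by
    have h1 : t ^ 2 ≤ lam ^ 2 := sq_le_sq' ht.1 ht.2
    nlinarith [mul_nonneg hκ (sq_nonneg t)]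
  have hgc : ContinuousOn (fun t : ℝ => 1 / (1 - (1 - κ) * t ^ 2)) (Set.Icc (-lam) lam) :=
    continuousOn_const.div (by fun_prop) fun t ht => (hg t ht).ne'
  -- The substitution `t = v ψ` runs from `lam` down to `-lam` and removes the square root; evenness
  -- in `t` then produces the factor `2`.
  set v : ℝ → ℝ := fun ψ => lam * Real.cos ψ / Real.sqrt (1 + κ * (U * Real.sin ψ ^ 2)) with hv
  have hvmem : ∀ ψ, v ψ ∈ Set.Icc (-lam) lam := fun ψ => by
    have h1 : 1 ≤ Real.sqrt (1 + κ * (U * Real.sin ψ ^ 2)) :=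
      Real.one_le_sqrt.2 (le_add_of_nonneg_right (by positivity))
    have h2 : |v ψ| ≤ lam := by
      rw [hv, abs_div, abs_mul, abs_of_pos hl0, abs_of_nonneg (Real.sqrt_nonneg _)]
      refine div_le_of_le_mul₀ (Real.sqrt_nonneg _) hl0.le ?_
      exact mul_le_mul_of_nonneg_left ((Real.abs_cos_le_one ψ).trans h1) hl0.le
    exact abs_le.1 h2
  have hderiv : ∀ ψ ∈ Set.uIcc 0 π, HasDerivAt v (-lam * Real.sin ψ * (1 + κ * U) /
      ((1 + κ * (U * Real.sin ψ ^ 2)) * Real.sqrt (1 + κ * (U * Real.sin ψ ^ 2)))) ψ := by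
    intro ψ _
    have hr := Real.sqrt_pos.2 (hD ψ)
    have h := ((Real.hasDerivAt_cos ψ).const_mul lam).div
      ((((((Real.hasDerivAt_sin ψ).pow 2).const_mul U).const_mul κ).const_add 1).sqrt (hD ψ).ne')
      hr.ne'
    refine h.congr_deriv ?_
    have h2 := Real.sq_sqrt (hD ψ).le
    have h3 := Real.sin_sq_add_cos_sq ψ
    simp only [Pi.pow_apply]
    generalize Real.sqrt (1 + κ * (U * Real.sin ψ ^ 2)) = r at hr h2 ⊢
    rw [← h2]
    field_simp
    push_cast
    norm_num
    linear_combination (-2 * Real.sin ψ) * h2 - 2 * Real.sin ψ * κ * U * h3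
  have hsub := intervalIntegral.integral_comp_mul_deriv' (a := 0) (b := π) hderiv
    (Continuous.continuousOn (Continuous.div (by fun_prop) (by fun_prop) fun ψ =>
      (mul_pos (hD ψ) (Real.sqrt_pos.2 (hD ψ))).ne'))
    (hgc.mono (by rintro _ ⟨ψ, _, rfl⟩; exact hvmem ψ))
  have hv0 : v 0 = lam := by simp [hv]
  have hvπ : v π = -lam := by simp [hv]
  rw [hv0, hvπ, intervalIntegral.integral_symm (-lam) lam,
    integral_symm_of_even hl0.le hgc (by simp)] at hsub
  rw [integral_angleMeasure, ← intervalIntegral.integral_const_mul, eq_comm, ← neg_inj, ← hsub,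
    ← intervalIntegral.integral_neg]
  refine intervalIntegral.integral_congr fun ψ _ => ?_
  have hr := Real.sqrt_pos.2 (hD ψ)
  have h2 := Real.sq_sqrt (hD ψ).le
  have h3 := Real.sin_sq_add_cos_sq ψ
  have h4 : 0 < 1 - (1 - κ) * v ψ ^ 2 := hg _ (hvmem ψ)
  have h5 : 1 - (1 - κ) * v ψ ^ 2 = (1 + κ * U) * ((1 - lam ^ 2) * (1 + U * Real.sin ψ ^ 2)) /
      (1 + κ * (U * Real.sin ψ ^ 2)) := by
    rw [hv, div_pow, h2, eq_div_iff (hD ψ).ne', sub_mul, mul_assoc,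
      div_mul_cancel₀ _ (hD ψ).ne']
    have h6 : Real.cos ψ ^ 2 = 1 - Real.sin ψ ^ 2 := by linarith
    rw [mul_pow, h6]
    linear_combination (κ * (Real.sin ψ ^ 2 - 1) - (1 + κ * U) * Real.sin ψ ^ 2) * hUl
  have h7 : U / lam = lam / (1 - lam ^ 2) := by
    rw [hU]; field_simp
  simp only [Function.comp_apply]
  rw [h5, h7]
  have h8 := hD ψ
  have h9 : 0 < 1 + U * Real.sin ψ ^ 2 := by positivity
  have h10 : 0 < 1 + κ * U := by positivity
  generalize Real.sqrt (1 + κ * (U * Real.sin ψ ^ 2)) = r at hr h2 ⊢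
  field_simp

theorem integral_one_div_mul_one_add {a z : ℝ} (hz : 0 ≤ z) :
    ∫ φ, 1 / (a * (1 + z * Real.sin φ ^ 2)) ∂angleMeasure = π / (a * Real.sqrt (1 + z)) := by
  have h : ∀ φ : ℝ, 1 / (a * (1 + z * Real.sin φ ^ 2)) = 1 / a * (1 / (1 + z * Real.sin φ ^ 2)) :=
    fun φ => one_div_mul_one_div .. |>.symm
  simp only [h]
  rw [integral_const_mul, integral_angle_inv_one_add_sin_sq (by linarith), div_mul_div_comm, one_mul]

/-- `F(lam, k)` as an average of elementary integrals. -/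
theorem ellipticF_eq_integral_angle {lam k : ℝ} (hlam : lam ∈ Set.Ioo (0 : ℝ) 1)
    (hk : k ∈ Set.Icc (0 : ℝ) 1) :
    π * ellipticF lam k = ∫ φ, (∫ t in (0 : ℝ)..lam,
      1 / (1 - (1 - (1 - k ^ 2) * Real.sin φ ^ 2) * t ^ 2)) ∂angleMeasure := by
  obtain ⟨hl0, hl1⟩ := hlam
  have hm : 0 ≤ 1 - k ^ 2 := by nlinarith [hk.1, hk.2]
  have ht2 : ∀ t ∈ Set.Icc 0 lam, 0 < 1 - t ^ 2 := fun t ht => by nlinarith [ht.1, ht.2]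
  have hden : ∀ t ∈ Set.Icc 0 lam, ∀ φ : ℝ,
      0 < 1 - (1 - (1 - k ^ 2) * Real.sin φ ^ 2) * t ^ 2 := fun t ht φ => by
    have : 0 ≤ (1 - k ^ 2) * Real.sin φ ^ 2 * t ^ 2 := by positivity
    linarith [ht2 t ht]
  simp only [intervalIntegral.integral_of_le hl0.le]
  rw [angleMeasure, integral_integral_swap]
  · rw [ellipticF, intervalIntegral.integral_of_le hl0.le, ← integral_const_mul]
    refine setIntegral_congr_fun measurableSet_Ioc fun t ht => ?_
    have ht' := Set.Ioc_subset_Icc_self ht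
    have h1 := ht2 t ht'
    -- This `z` is chosen so that `(1 - t²)(1 - k² t²) = (1 - t²)² (1 + z)`; Poisson's integral then
    -- undoes the square root in `F`.
    have h2 := integral_one_div_mul_one_add (a := 1 - t ^ 2)
      (z := (1 - k ^ 2) * t ^ 2 / (1 - t ^ 2)) (by positivity)
    have h3 : ∀ φ : ℝ, 1 / (1 - (1 - (1 - k ^ 2) * Real.sin φ ^ 2) * t ^ 2) =
        1 / ((1 - t ^ 2) * (1 + (1 - k ^ 2) * t ^ 2 / (1 - t ^ 2) * Real.sin φ ^ 2)) := fun φ => by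
      congr 1
      field_simp
      ring
    simp only [h3]
    rw [angleMeasure] at h2
    rw [h2, ← mul_one_div]
    congr 2
    rw [show (1 - t ^ 2) * (1 - k ^ 2 * t ^ 2)
      = (1 - t ^ 2) ^ 2 * (1 + (1 - k ^ 2) * t ^ 2 / (1 - t ^ 2)) by field_simp; ring,
      Real.sqrt_mul (by positivity), Real.sqrt_sq h1.le, one_mul, one_div]
  · refine integrable_restrict_prod_of_continuousOn (ContinuousOn.div (by fun_prop) (by fun_prop) ?_)
    rintro ⟨φ, t⟩ ⟨_, ht⟩
    exact (hden t ht φ).ne'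

/-- `F(lam, k)` as a triple integral. -/
theorem ellipticF_eq_integral_triple {lam k U : ℝ} (hlam : lam ∈ Set.Ioo (0 : ℝ) 1)
    (hk : k ∈ Set.Icc (0 : ℝ) 1) (hU : U = lam ^ 2 / (1 - lam ^ 2)) :
    ellipticF lam k = U / lam / (2 * π ^ 2) * ∫ ω, Real.sin ω.1 /
      ((1 + U * Real.sin ω.1 ^ 2) *
        (1 + (1 - k ^ 2) * (U * Real.sin ω.1 ^ 2) * sinSqProd ω.2))
      ∂angleMeasure.prod pairMeasure := by
  have hm : 0 ≤ 1 - k ^ 2 := by nlinarith [hk.1, hk.2]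
  have hl2 : 0 < 1 - lam ^ 2 := by nlinarith [hlam.1, hlam.2]
  have hU0 : 0 < U := by rw [hU]; have := hlam.1; positivity
  set m := 1 - k ^ 2
  have hc := continuous_sinSqProd
  have hT := sinSqProd_nonneg
  have hint : Integrable (fun ω : ℝ × ℝ × ℝ => Real.sin ω.1 / ((1 + U * Real.sin ω.1 ^ 2) *
      (1 + m * (U * Real.sin ω.1 ^ 2) * sinSqProd ω.2))) (angleMeasure.prod pairMeasure) := by
    refine integrable_triple_of_continuous (Continuous.div (by fun_prop) (by fun_prop) fun ω => ?_)
    have := hT ω.2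
    positivity
  -- Integrating out `φ` by Poisson's formula leaves the integrand of `integral_angle_sin_div_sqrt`
  -- with `κ = m sin² θ`.
  have hinner : ∀ ψ, ∫ p, Real.sin ψ / ((1 + U * Real.sin ψ ^ 2) *
      (1 + m * (U * Real.sin ψ ^ 2) * sinSqProd p)) ∂pairMeasure
      = ∫ θ, π * (Real.sin ψ / ((1 + U * Real.sin ψ ^ 2) *
        Real.sqrt (1 + m * Real.sin θ ^ 2 * (U * Real.sin ψ ^ 2)))) ∂angleMeasure := fun ψ => by
    rw [pairMeasure, integral_prod]
    · refine integral_congr_ae (.of_forall fun θ => ?_)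
      have h2 := integral_one_div_mul_one_add (a := 1 + U * Real.sin ψ ^ 2)
        (z := m * Real.sin θ ^ 2 * (U * Real.sin ψ ^ 2)) (by positivity)
      have h3 : ∀ φ : ℝ, Real.sin ψ / ((1 + U * Real.sin ψ ^ 2) *
          (1 + m * (U * Real.sin ψ ^ 2) * sinSqProd (θ, φ))) = Real.sin ψ *
          (1 / ((1 + U * Real.sin ψ ^ 2) *
            (1 + m * Real.sin θ ^ 2 * (U * Real.sin ψ ^ 2) * Real.sin φ ^ 2))) := fun φ => by
        rw [mul_one_div, sinSqProd]
        ring_nf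
      simp only [h3]
      rw [integral_const_mul, h2]
      ring
    · refine integrable_pair_of_continuous (Continuous.div (by fun_prop) (by fun_prop) fun p => ?_)
      have := hT p
      positivity
  rw [integral_prod _ hint]
  simp only [hinner]
  rw [integral_integral_swap]
  · have hsub : ∀ θ, ∫ ψ, π * (Real.sin ψ / ((1 + U * Real.sin ψ ^ 2) *
        Real.sqrt (1 + m * Real.sin θ ^ 2 * (U * Real.sin ψ ^ 2)))) ∂angleMeasure
        = π * (lam / U * 2) * ∫ t in (0 : ℝ)..lam, 1 / (1 - (1 - m * Real.sin θ ^ 2) * t ^ 2) :=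
      fun θ => by
        have h := integral_angle_sin_div_sqrt hlam hU (κ := m * Real.sin θ ^ 2) (by positivity)
        have := hlam.1
        have key : ∀ I : ℝ, π * I = π * (lam / U * (U / lam * I)) := fun I => by field_simp
        rw [integral_const_mul, mul_assoc π, mul_assoc (lam / U), ← h]
        exact key _
    simp only [hsub]
    rw [integral_const_mul, ← ellipticF_eq_integral_angle hlam hk]
    have := hlam.1
    have := Real.pi_pos
    field_simp
  · refine integrable_pair_of_continuous
      (continuous_const.mul (Continuous.div (by fun_prop) (by fun_prop) fun p => ?_))
    positivity

/-! ### The remainder integral and the telescoping expansion -/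

/-- The integral representing minus the remainder of order `N`. -/
noncomputable def remInt (N : ℕ) (lam m U : ℝ) : ℝ :=
  m ^ (N + 1) * (U / lam) / (2 * π ^ 2) * ∫ ω, Real.sin ω.1 *
      (U * Real.sin ω.1 ^ 2 / (1 + U * Real.sin ω.1 ^ 2)) *
      (sinSqProd ω.2 ^ (N + 1) / (1 + m * (U * Real.sin ω.1 ^ 2) * sinSqProd ω.2))
    ∂angleMeasure.prod pairMeasure

theorem integral_angle_sin_div_eq_log {lam U : ℝ} (hlam : lam ∈ Set.Ioo (0 : ℝ) 1)
    (hU : U = lam ^ 2 / (1 - lam ^ 2)) :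
    U / lam * ∫ ψ, Real.sin ψ / (1 + U * Real.sin ψ ^ 2) ∂angleMeasure
      = Real.log ((1 + lam) / (1 - lam)) := by
  obtain ⟨hl0, hl1⟩ := hlam
  have hl2 : 0 < 1 - lam ^ 2 := by nlinarith
  have hU0 : 0 < U := by rw [hU]; positivity
  have h1 : 0 < 1 - lam := by linarith
  have hS : 1 / lam = Real.sqrt (1 + 1 / U) := by
    rw [eq_comm, Real.sqrt_eq_iff_mul_self_eq_of_pos (by positivity), hU]
    field_simp
    ring
  rw [integral_angle_sin_div_one_add hU0 hS]
  have h2 : (1 / lam + 1) / (1 / lam - 1) = (1 + lam) / (1 - lam) := by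
    have : 1 / lam - 1 ≠ 0 := by
      rw [sub_ne_zero]; exact (one_lt_one_div hl0 hl1).ne'
    field_simp
  rw [h2]
  field_simp

theorem integrable_remInt {m U : ℝ} (hm : 0 ≤ m) (hU : 0 ≤ U) (N : ℕ) :
    Integrable (fun ω : ℝ × ℝ × ℝ => Real.sin ω.1 *
      (U * Real.sin ω.1 ^ 2 / (1 + U * Real.sin ω.1 ^ 2)) *
      (sinSqProd ω.2 ^ (N + 1) / (1 + m * (U * Real.sin ω.1 ^ 2) * sinSqProd ω.2)))
      (angleMeasure.prod pairMeasure) := by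
  have hc := continuous_sinSqProd
  refine integrable_triple_of_continuous (Continuous.mul (Continuous.mul (by fun_prop)
    (Continuous.div (by fun_prop) (by fun_prop) fun ω => ?_))
    (Continuous.div (by fun_prop) (by fun_prop) fun ω => ?_))
  · positivity
  · have := sinSqProd_nonneg ω.2
    positivity

theorem integrable_sin_div {U : ℝ} (hU : 0 ≤ U) :
    Integrable (fun ψ => Real.sin ψ / (1 + U * Real.sin ψ ^ 2)) angleMeasure :=
  integrable_angle_of_continuous (Continuous.div (by fun_prop) (by fun_prop) fun ψ => by positivity)

/-- Pointwise, `1 / ((1 + v)(1 + m v T)) + m v T / ((1 + v)(1 + m v T)) = 1 / (1 + v)` with `v = U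
sin² ψ`: the base case of the telescoping. -/
theorem remInt_zero {lam k U : ℝ} (hlam : lam ∈ Set.Ioo (0 : ℝ) 1)
    (hk : k ∈ Set.Icc (0 : ℝ) 1) (hU : U = lam ^ 2 / (1 - lam ^ 2)) :
    ellipticF lam k + remInt 0 lam (1 - k ^ 2) U = 1 / 2 * Real.log ((1 + lam) / (1 - lam)) := by
  have hm : 0 ≤ 1 - k ^ 2 := by nlinarith [hk.1, hk.2]
  have hl2 : 0 < 1 - lam ^ 2 := by nlinarith [hlam.1, hlam.2]
  have hU0 : 0 < U := by rw [hU]; have := hlam.1; positivity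
  have hc := continuous_sinSqProd
  have hπ := Real.pi_pos
  rw [ellipticF_eq_integral_triple hlam hk hU, remInt, ← integral_angle_sin_div_eq_log hlam hU]
  set m := 1 - k ^ 2
  have hint : Integrable (fun ω : ℝ × ℝ × ℝ => Real.sin ω.1 / ((1 + U * Real.sin ω.1 ^ 2) *
      (1 + m * (U * Real.sin ω.1 ^ 2) * sinSqProd ω.2))) (angleMeasure.prod pairMeasure) := by
    refine integrable_triple_of_continuous (Continuous.div (by fun_prop) (by fun_prop) fun ω => ?_)
    have := sinSqProd_nonneg ω.2
    positivity
  have hI := (integrable_remInt hm hU0.le 0).const_mul m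
  have hsum := integral_add hint hI
  rw [integral_const_mul] at hsum
  have hpt : ∀ ω : ℝ × ℝ × ℝ, Real.sin ω.1 / ((1 + U * Real.sin ω.1 ^ 2) *
      (1 + m * (U * Real.sin ω.1 ^ 2) * sinSqProd ω.2)) + m * (Real.sin ω.1 *
      (U * Real.sin ω.1 ^ 2 / (1 + U * Real.sin ω.1 ^ 2)) *
      (sinSqProd ω.2 ^ (0 + 1) / (1 + m * (U * Real.sin ω.1 ^ 2) * sinSqProd ω.2)))
      = Real.sin ω.1 / (1 + U * Real.sin ω.1 ^ 2) * sinSqProd ω.2 ^ 0 := fun ω => by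
    have := sinSqProd_nonneg ω.2
    have h1 : 0 < 1 + m * (U * Real.sin ω.1 ^ 2) * sinSqProd ω.2 := by positivity
    have h2 : 0 < 1 + U * Real.sin ω.1 ^ 2 := by positivity
    generalize sinSqProd ω.2 = T at *
    field_simp
    ring
  simp only [hpt] at hsum
  rw [integral_prod_mul (fun ψ => Real.sin ψ / (1 + U * Real.sin ψ ^ 2))
    (fun p => sinSqProd p ^ 0), integral_sinSqProd_pow, centralCoef_zero] at hsum
  have h1 : ∀ I J K : ℝ, K * (π ^ 2 * 1 ^ 2) = I + m * J → U / lam / (2 * π ^ 2) * I +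
      m ^ (0 + 1) * (U / lam) / (2 * π ^ 2) * J = 1 / 2 * (U / lam * K) := fun I J K h => by
    have h' : K = (I + m * J) / π ^ 2 := by
      rw [← h]; field_simp
    rw [h']
    field_simp
    ring
  exact h1 _ _ _ hsum

/-- The difference carries the factor `1 - m T`, and `v (1 - m T) = (1 + v) - (1 + m v T)` splits it
into the integral for `s_N` and a product of the logarithm integral with a moment. -/
theorem remInt_sub_remInt_succ {lam k U : ℝ} (hlam : lam ∈ Set.Ioo (0 : ℝ) 1)
    (hk : k ∈ Set.Icc (0 : ℝ) 1) (hU : U = lam ^ 2 / (1 - lam ^ 2)) (N : ℕ) :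
    remInt N lam (1 - k ^ 2) U = remInt (N + 1) lam (1 - k ^ 2) U
      - 1 / 2 * Real.log ((1 + lam) / (1 - lam)) * (centralCoef (N + 1) ^ 2 * (1 - k ^ 2) ^ (N + 1))
      - 1 / (2 * lam) * ((-1 / U) ^ N * s N ((1 - k ^ 2) * U)) := by
  have hm : 0 ≤ 1 - k ^ 2 := by nlinarith [hk.1, hk.2]
  have hl2 : 0 < 1 - lam ^ 2 := by nlinarith [hlam.1, hlam.2]
  have hU0 : 0 < U := by rw [hU]; have := hlam.1; positivity
  have hl0 := hlam.1
  have hc := continuous_sinSqProd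
  have hπ := Real.pi_pos
  rw [s_eq_sInt (by nlinarith), ← integral_angle_sin_div_eq_log hlam hU, remInt, remInt, sInt]
  set m := 1 - k ^ 2
  have hI := integrable_remInt hm hU0.le N
  have hI' := (integrable_remInt hm hU0.le (N + 1)).const_mul m
  have hsub := integral_sub hI hI'
  rw [integral_const_mul] at hsub
  have hS : Integrable (fun ω : ℝ × ℝ × ℝ => sinSqProd ω.2 ^ (N + 1) * Real.sin ω.1 /
      (1 + m * U * (sinSqProd ω.2 * Real.sin ω.1 ^ 2))) (angleMeasure.prod pairMeasure) := by
    refine integrable_triple_of_continuous (Continuous.div (by fun_prop) (by fun_prop) fun ω => ?_)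
    have := sinSqProd_nonneg ω.2
    positivity
  have hJ : Integrable (fun ω : ℝ × ℝ × ℝ => Real.sin ω.1 / (1 + U * Real.sin ω.1 ^ 2) *
      sinSqProd ω.2 ^ (N + 1)) (angleMeasure.prod pairMeasure) := by
    refine integrable_triple_of_continuous (Continuous.mul (Continuous.div (by fun_prop)
      (by fun_prop) fun ω => ?_) (by fun_prop))
    positivity
  have hsub' := integral_sub hS hJ
  rw [integral_prod_mul (fun ψ => Real.sin ψ / (1 + U * Real.sin ψ ^ 2))
    (fun p => sinSqProd p ^ (N + 1)), integral_sinSqProd_pow] at hsub'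
  have hpt : ∀ ω : ℝ × ℝ × ℝ, Real.sin ω.1 *
      (U * Real.sin ω.1 ^ 2 / (1 + U * Real.sin ω.1 ^ 2)) *
      (sinSqProd ω.2 ^ (N + 1) / (1 + m * (U * Real.sin ω.1 ^ 2) * sinSqProd ω.2)) -
      m * (Real.sin ω.1 * (U * Real.sin ω.1 ^ 2 / (1 + U * Real.sin ω.1 ^ 2)) *
      (sinSqProd ω.2 ^ (N + 1 + 1) / (1 + m * (U * Real.sin ω.1 ^ 2) * sinSqProd ω.2)))
      = sinSqProd ω.2 ^ (N + 1) * Real.sin ω.1 /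
        (1 + m * U * (sinSqProd ω.2 * Real.sin ω.1 ^ 2)) -
        Real.sin ω.1 / (1 + U * Real.sin ω.1 ^ 2) * sinSqProd ω.2 ^ (N + 1) := fun ω => by
    have := sinSqProd_nonneg ω.2
    have h1 : 0 < 1 + m * (U * Real.sin ω.1 ^ 2) * sinSqProd ω.2 := by positivity
    have h2 : 0 < 1 + U * Real.sin ω.1 ^ 2 := by positivity
    rw [show m * U * (sinSqProd ω.2 * Real.sin ω.1 ^ 2)
      = m * (U * Real.sin ω.1 ^ 2) * sinSqProd ω.2 by ring]
    generalize sinSqProd ω.2 = T at *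
    rw [pow_succ T (N + 1)]
    field_simp
    ring
  simp only [hpt] at hsub
  rw [hsub] at hsub'
  have key : ∀ I I' S J : ℝ, I - m * I' = S - J * (π ^ 2 * centralCoef (N + 1) ^ 2) →
      m ^ (N + 1) * (U / lam) / (2 * π ^ 2) * I
        = m ^ (N + 1 + 1) * (U / lam) / (2 * π ^ 2) * I'
          - 1 / 2 * (U / lam * J) * (centralCoef (N + 1) ^ 2 * m ^ (N + 1))
          - 1 / (2 * lam) * ((-1 / U) ^ N * ((-(m * U)) ^ (N + 1) / π ^ 2 * S)) := by
    intro I I' S J h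
    have h1 : (-1 / U) ^ N * (-(m * U)) ^ (N + 1) = -(m ^ (N + 1) * U) := by
      rw [pow_succ (-(m * U)), ← mul_assoc, ← mul_pow,
        show -1 / U * -(m * U) = m by field_simp, pow_succ]
      ring
    have h2 : (-1 / U) ^ N * ((-(m * U)) ^ (N + 1) / π ^ 2 * S)
        = -(m ^ (N + 1) * U) / π ^ 2 * S := by
      rw [← h1]; ring
    rw [h2, show I = m * I' + S - J * (π ^ 2 * centralCoef (N + 1) ^ 2) by linarith]
    field_simp
    ring
  exact key _ _ _ _ hsub'

theorem ellipticF_eq_expansion_sub {lam k U : ℝ} (hlam : lam ∈ Set.Ioo (0 : ℝ) 1)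
    (hk : k ∈ Set.Icc (0 : ℝ) 1) (hU : U = lam ^ 2 / (1 - lam ^ 2)) (N : ℕ) :
    ellipticF lam k = expansion N lam k - remInt N lam (1 - k ^ 2) U := by
  have hl2 : 0 < 1 - lam ^ 2 := by nlinarith [hlam.1, hlam.2]
  have hl0 := hlam.1
  have e1 : (1 - lam ^ 2) / (-lam ^ 2) = -1 / U := by
    rw [hU, div_neg, neg_div, one_div_div]
  have e2 : (1 - k ^ 2) * lam ^ 2 / (1 - lam ^ 2) = (1 - k ^ 2) * U := by
    rw [hU, mul_div_assoc]
  induction N with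
  | zero =>
    rw [expansion]
    simp only [Finset.range_one, Finset.sum_singleton, Finset.range_zero, Finset.sum_empty,
      poch_zero, zero_add]
    have := remInt_zero hlam hk hU
    simp
    linarith
  | succ N ih =>
    rw [ih, remInt_sub_remInt_succ hlam hk hU N, expansion, expansion,
      Finset.sum_range_succ _ (N + 1), Finset.sum_range_succ _ N, Finset.sum_range_succ _ N, e1, e2, centralCoef]
    ring

/-! ### The means `α_N` and the integral for `f_N` -/

theorem alpha_pos (N : ℕ) : 0 < alpha N := by
  unfold alpha; positivity

theorem alpha_lt_one (N : ℕ) : alpha N < 1 := by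
  rw [alpha, div_lt_one (by positivity)]
  gcongr
  norm_num

theorem alpha_lt_alpha_succ (N : ℕ) : alpha N < alpha (N + 1) := by
  rw [alpha, alpha, ← div_pow, ← div_pow]
  refine pow_lt_pow_left₀ ?_ (by positivity) two_ne_zero
  rw [div_lt_div_iff₀ (by positivity) (by positivity)]
  push_cast
  nlinarith

/-- Thus `alpha N` is the ratio of consecutive moments of `sinSqProd`, that is, its mean under the
density proportional to `sinSqProd ^ N`. -/
theorem alpha_mul_centralCoef_sq (N : ℕ) :
    alpha N * centralCoef N ^ 2 = centralCoef (N + 1) ^ 2 := by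
  rw [alpha, centralCoef_succ, mul_pow, div_pow]
  ring

/-- The integral in terms of which `f_N` is expressed. -/
noncomputable def fInt (β U : ℝ) : ℝ :=
  ∫ ψ, Real.sin ψ * (U * Real.sin ψ ^ 2 / (1 + U * Real.sin ψ ^ 2)) *
    (1 / (1 + β * (U * Real.sin ψ ^ 2))) ∂angleMeasure

theorem continuous_fInt_integrand {β U : ℝ} (hβ : 0 ≤ β) (hU : 0 ≤ U) :
    Continuous fun ψ => Real.sin ψ * (U * Real.sin ψ ^ 2 / (1 + U * Real.sin ψ ^ 2)) *
      (1 / (1 + β * (U * Real.sin ψ ^ 2))) := by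
  refine Continuous.mul (Continuous.mul (by fun_prop)
    (Continuous.div (by fun_prop) (by fun_prop) fun ψ => ?_))
    (Continuous.div (by fun_prop) (by fun_prop) fun ψ => ?_) <;> positivity

/-- Partial fractions: `(1 - β) v / ((1 + v)(1 + β v)) = 1 / (1 + β v) - 1 / (1 + v)` with `β = α_N
(1 - k²)`, where `0 < β < 1`. Each piece integrates to a logarithm. -/
theorem f_eq_fInt {lam k U : ℝ} (hlam : lam ∈ Set.Ioo (0 : ℝ) 1) (hk : k ∈ Set.Ico (0 : ℝ) 1)
    (hU : U = lam ^ 2 / (1 - lam ^ 2)) (N : ℕ) :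
    f N lam k = (1 - k ^ 2) * (U / lam) * fInt (alpha N * (1 - k ^ 2)) U := by
  have hl2 : 0 < 1 - lam ^ 2 := by nlinarith [hlam.1, hlam.2]
  have hl0 := hlam.1
  have hU0 : 0 < U := by rw [hU]; positivity
  have hm : 0 < 1 - k ^ 2 := by nlinarith [hk.1, hk.2]
  have hm1 : 1 - k ^ 2 ≤ 1 := by linarith [sq_nonneg k]
  have hα := alpha_pos N
  have hβ1 : alpha N * (1 - k ^ 2) < 1 :=
    (mul_le_of_le_one_right hα.le hm1).trans_lt (alpha_lt_one N)
  rw [f, if_neg hk.2.ne]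
  set m := 1 - k ^ 2
  set β := alpha N * m with hβ
  have hβ0 : 0 < β := mul_pos hα hm
  have hS : rootTerm N lam k = Real.sqrt (1 + 1 / (β * U)) := by
    rw [rootTerm, hU, hβ]
    congr 2
    rw [show 1 - k ^ 2 = m from rfl]
    field_simp
  have h1 := integral_angle_sin_div_one_add (mul_pos hβ0 hU0) hS
  have hS0 : 0 < rootTerm N lam k := by rw [hS]; exact Real.sqrt_pos.2 (by positivity)
  rw [← integral_angle_sin_div_eq_log hlam hU]
  have hsub := integral_sub (integrable_sin_div (mul_pos hβ0 hU0).le) (integrable_sin_div hU0.le)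
  have hpt : ∀ ψ, Real.sin ψ / (1 + β * U * Real.sin ψ ^ 2) - Real.sin ψ / (1 + U * Real.sin ψ ^ 2)
      = (1 - β) * (Real.sin ψ * (U * Real.sin ψ ^ 2 / (1 + U * Real.sin ψ ^ 2)) *
        (1 / (1 + β * (U * Real.sin ψ ^ 2)))) := fun ψ => by
    rw [mul_assoc β]
    have h2 : 0 < 1 + β * (U * Real.sin ψ ^ 2) := by positivity
    have h3 : 0 < 1 + U * Real.sin ψ ^ 2 := by positivity
    field_simp
    ring
  simp only [hpt] at hsub
  rw [integral_const_mul, h1, ← fInt] at hsub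
  have h4 : 1 - β ≠ 0 := by linarith
  have h5 : fInt β U = (1 / (β * U * rootTerm N lam k) * Real.log ((rootTerm N lam k + 1) /
      (rootTerm N lam k - 1)) - ∫ ψ, Real.sin ψ / (1 + U * Real.sin ψ ^ 2) ∂angleMeasure) /
      (1 - β) := by
    rw [← hsub]; field_simp
  rw [h5]
  generalize ∫ ψ, Real.sin ψ / (1 + U * Real.sin ψ ^ 2) ∂angleMeasure = J
  generalize Real.log _ = L
  generalize rootTerm N lam k = S at *
  have h6 : 1 / (alpha N * lam * S) * L = m * (U / lam) * (1 / (β * U * S) * L) := by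
    rw [hβ]
    field_simp
  rw [h6]
  field_simp

theorem fInt_lt_fInt {β β' U : ℝ} (hβ : 0 ≤ β) (h : β < β') (hU : 0 < U) :
    fInt β' U < fInt β U := by
  have hc := continuous_fInt_integrand hβ hU.le
  have hc' := continuous_fInt_integrand (hβ.trans h.le) hU.le
  rw [fInt, fInt, integral_angleMeasure, integral_angleMeasure]
  refine intervalIntegral.integral_lt_integral_of_continuousOn_of_le_of_exists_lt Real.pi_pos
    hc'.continuousOn hc.continuousOn (fun ψ hψ => ?_) ⟨π / 2, ⟨by positivity, by
      linarith [Real.pi_pos]⟩, ?_⟩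
  · have := Real.sin_nonneg_of_mem_Icc (Set.Ioc_subset_Icc_self hψ)
    gcongr
  · simp only [Real.sin_pi_div_two, one_pow, mul_one, one_mul]
    gcongr

theorem fInt_pos {β U : ℝ} (hβ : 0 ≤ β) (hU : 0 < U) : 0 < fInt β U := by
  rw [fInt, integral_angleMeasure]
  refine intervalIntegral.intervalIntegral_pos_of_pos_on
    ((continuous_fInt_integrand hβ hU.le).intervalIntegrable _ _) (fun ψ hψ => ?_) Real.pi_pos
  have := Real.sin_pos_of_mem_Ioo hψ
  positivity

theorem fInt_le_two {β U : ℝ} (hβ : 0 ≤ β) (hU : 0 ≤ U) : fInt β U ≤ 2 := by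
  have h2 : ∫ ψ in (0 : ℝ)..π, Real.sin ψ = 2 := by simp; norm_num
  rw [fInt, integral_angleMeasure, ← h2]
  refine intervalIntegral.integral_mono_on Real.pi_pos.le
    ((continuous_fInt_integrand hβ hU).intervalIntegrable _ _)
    (Real.continuous_sin.intervalIntegrable _ _) fun ψ hψ => ?_
  have h := Real.sin_nonneg_of_mem_Icc hψ
  have h1 : U * Real.sin ψ ^ 2 / (1 + U * Real.sin ψ ^ 2) ≤ 1 := by
    rw [div_le_one (by positivity)]; linarith
  have h2 : 1 / (1 + β * (U * Real.sin ψ ^ 2)) ≤ 1 := by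
    rw [div_le_one (by positivity)]; exact le_add_of_nonneg_right (by positivity)
  calc _ ≤ Real.sin ψ * 1 * 1 := by gcongr
    _ = _ := by ring

/-! ### Two-sided bounds for the remainder and for `f_N` -/

/-- The Jensen bounds for the averages of `T / (1 + a T)`. -/
theorem integral_pair_bounds {a : ℝ} (ha : 0 ≤ a) (N : ℕ) :
    π ^ 2 * centralCoef (N + 1) ^ 2 * (1 / (1 + alpha (N + 1) * a)) ≤
        ∫ p, sinSqProd p ^ (N + 1) / (1 + a * sinSqProd p) ∂pairMeasure ∧
      ∫ p, sinSqProd p ^ (N + 1) / (1 + a * sinSqProd p) ∂pairMeasure ≤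
        π ^ 2 * centralCoef (N + 1) ^ 2 * (1 / (1 + alpha N * a)) := by
  have hc := continuous_sinSqProd
  have hint : Integrable (fun p => sinSqProd p ^ (N + 1) / (1 + a * sinSqProd p)) pairMeasure := by
    refine integrable_pair_of_continuous (Continuous.div (by fun_prop) (by fun_prop) fun p => ?_)
    have := sinSqProd_nonneg p
    positivity
  have hlin : ∀ u v : ℝ, ∀ j : ℕ, Integrable
      (fun p => u * sinSqProd p ^ j + v * sinSqProd p ^ (j + 1)) pairMeasure := fun u v j =>
    integrable_pair_of_continuous (by fun_prop)
  have hval : ∀ u v : ℝ, ∀ j : ℕ, ∫ p, (u * sinSqProd p ^ j + v * sinSqProd p ^ (j + 1))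
      ∂pairMeasure = π ^ 2 * centralCoef j ^ 2 * (u + v * alpha j) := fun u v j => by
    rw [integral_add (integrable_pair_of_continuous (by fun_prop))
      (integrable_pair_of_continuous (by fun_prop)), integral_const_mul, integral_const_mul,
      integral_sinSqProd_pow, integral_sinSqProd_pow, ← alpha_mul_centralCoef_sq]
    ring
  constructor
  · have hα := alpha_pos (N + 1)
    set α := alpha (N + 1)
    have hd : 0 < 1 + α * a := by positivity
    -- The tangent line at `α_{N+1}` of the convex function `1 / (1 + a T)`, weighted by `T^(N+1)`.
    have h := integral_mono (hlin (1 / (1 + α * a) + a * α / (1 + α * a) ^ 2)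
      (-a / (1 + α * a) ^ 2) (N + 1)) hint fun p => by
        have hT := sinSqProd_nonneg p
        have hT' : 0 < 1 + a * sinSqProd p := by positivity
        generalize sinSqProd p = T at *
        have e : T ^ (N + 1) / (1 + a * T) - ((1 / (1 + α * a) + a * α / (1 + α * a) ^ 2) *
            T ^ (N + 1) + -a / (1 + α * a) ^ 2 * T ^ (N + 1 + 1))
            = T ^ (N + 1) * (a * (T - α)) ^ 2 / ((1 + a * T) * (1 + α * a) ^ 2) := by
          rw [pow_succ T (N + 1)]
          field_simp
          ring
        have : 0 ≤ T ^ (N + 1) * (a * (T - α)) ^ 2 / ((1 + a * T) * (1 + α * a) ^ 2) := by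
          positivity
        linarith
    rw [hval] at h
    refine le_of_eq_of_le ?_ h
    congr 1
    field_simp
    ring
  · have hα := alpha_pos N
    have hαc := alpha_mul_centralCoef_sq N
    rw [← hαc]
    set α := alpha N with hαdef
    have hd : 0 < 1 + α * a := by positivity
    -- One power of `T` is moved from the weight into the function: the tangent line at `α_N` of the
    -- concave `T / (1 + a T)`, weighted by `T^N`. Hence the upper bound carries index `N`.
    have h := integral_mono hint (hlin (α / (1 + α * a) - α / (1 + α * a) ^ 2)
      (1 / (1 + α * a) ^ 2) N) fun p => by
        have hT := sinSqProd_nonneg p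
        have hT' : 0 < 1 + a * sinSqProd p := by positivity
        generalize sinSqProd p = T at *
        have e : ((α / (1 + α * a) - α / (1 + α * a) ^ 2) * T ^ N +
            1 / (1 + α * a) ^ 2 * T ^ (N + 1)) - T ^ (N + 1) / (1 + a * T)
            = T ^ N * (a * (T - α) ^ 2) / ((1 + a * T) * (1 + α * a) ^ 2) := by
          rw [pow_succ T N]
          field_simp
          ring
        have : 0 ≤ T ^ N * (a * (T - α) ^ 2) / ((1 + a * T) * (1 + α * a) ^ 2) := by
          positivity
        linarith
    rw [hval] at h
    refine le_of_le_of_eq h ?_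
    rw [← hαdef]
    field_simp
    ring

/-- For fixed `ψ` the Jensen bounds apply with `a = m U sin² ψ`; the remaining weight in `ψ` is
nonnegative on `(0, π]`. -/
theorem remInt_bounds {lam m U : ℝ} (hlam : 0 < lam) (hm : 0 ≤ m) (hU : 0 ≤ U) (N : ℕ) :
    m ^ (N + 1) * (U / lam) / 2 * centralCoef (N + 1) ^ 2 * fInt (alpha (N + 1) * m) U ≤
        remInt N lam m U ∧
      remInt N lam m U ≤
        m ^ (N + 1) * (U / lam) / 2 * centralCoef (N + 1) ^ 2 * fInt (alpha N * m) U := by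
  have hI := integrable_remInt hm hU N
  have hπ := Real.pi_pos
  have hsin : ∀ᵐ ψ ∂angleMeasure, 0 ≤ Real.sin ψ := by
    refine (ae_restrict_iff' measurableSet_Ioc).2 (.of_forall fun ψ hψ => ?_)
    exact Real.sin_nonneg_of_mem_Icc (Set.Ioc_subset_Icc_self hψ)
  have hIl := hI.integral_prod_left
  rw [remInt, integral_prod _ hI]
  simp only [integral_const_mul] at hIl ⊢
  have hscale : ∀ X : ℝ, m ^ (N + 1) * (U / lam) / 2 * centralCoef (N + 1) ^ 2 * X =
      m ^ (N + 1) * (U / lam) / (2 * π ^ 2) * (π ^ 2 * centralCoef (N + 1) ^ 2 * X) := fun X => by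
    field_simp
  rw [hscale, hscale, fInt, fInt, ← integral_const_mul (π ^ 2 * centralCoef (N + 1) ^ 2),
    ← integral_const_mul (π ^ 2 * centralCoef (N + 1) ^ 2)]
  have hint : ∀ j, Integrable (fun ψ => π ^ 2 * centralCoef (N + 1) ^ 2 *
      (Real.sin ψ * (U * Real.sin ψ ^ 2 / (1 + U * Real.sin ψ ^ 2)) *
      (1 / (1 + alpha j * m * (U * Real.sin ψ ^ 2))))) angleMeasure := fun j =>
    integrable_angle_of_continuous (continuous_const.mul
      (continuous_fInt_integrand (mul_nonneg (alpha_pos j).le hm) hU))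
  have hpre : 0 ≤ m ^ (N + 1) * (U / lam) / (2 * π ^ 2) := by positivity
  constructor
  · refine mul_le_mul_of_nonneg_left (integral_mono_ae (hint _) hIl ?_) hpre
    filter_upwards [hsin] with ψ hψ
    have hb := (integral_pair_bounds (a := m * (U * Real.sin ψ ^ 2)) (by positivity) N).1
    rw [← mul_assoc (alpha _)] at hb
    rw [mul_left_comm (π ^ 2 * centralCoef (N + 1) ^ 2)]
    exact mul_le_mul_of_nonneg_left hb (by positivity)
  · refine mul_le_mul_of_nonneg_left (integral_mono_ae hIl (hint _) ?_) hpre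
    filter_upwards [hsin] with ψ hψ
    have hb := (integral_pair_bounds (a := m * (U * Real.sin ψ ^ 2)) (by positivity) N).2
    rw [← mul_assoc (alpha _)] at hb
    rw [mul_left_comm (π ^ 2 * centralCoef (N + 1) ^ 2)]
    exact mul_le_mul_of_nonneg_left hb (by positivity)

theorem errCoef_mul_f {lam k U : ℝ} (hlam : lam ∈ Set.Ioo (0 : ℝ) 1) (hk : k ∈ Set.Ico (0 : ℝ) 1)
    (hU : U = lam ^ 2 / (1 - lam ^ 2)) (N j : ℕ) :
    errCoef N k * f j lam k = (1 - k ^ 2) ^ (N + 1) * (U / lam) / 2 * centralCoef (N + 1) ^ 2 *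
      fInt (alpha j * (1 - k ^ 2)) U := by
  rw [f_eq_fInt hlam hk hU, errCoef, centralCoef]
  ring

theorem f_pos {lam k : ℝ} (hlam : lam ∈ Set.Ioo (0 : ℝ) 1) (hk : k ∈ Set.Ico (0 : ℝ) 1) (N : ℕ) :
    0 < f N lam k := by
  have hl2 : 0 < 1 - lam ^ 2 := by nlinarith [hlam.1, hlam.2]
  have hl0 := hlam.1
  have hm : 0 < 1 - k ^ 2 := by nlinarith [hk.1, hk.2]
  have hU0 : 0 < lam ^ 2 / (1 - lam ^ 2) := by positivity
  rw [f_eq_fInt hlam hk rfl]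
  have := fInt_pos (mul_pos (alpha_pos N) hm).le hU0
  positivity

theorem f_succ_lt {lam k : ℝ} (hlam : lam ∈ Set.Ioo (0 : ℝ) 1) (hk : k ∈ Set.Ico (0 : ℝ) 1)
    (N : ℕ) : f (N + 1) lam k < f N lam k := by
  have hl2 : 0 < 1 - lam ^ 2 := by nlinarith [hlam.1, hlam.2]
  have hl0 := hlam.1
  have hm : 0 < 1 - k ^ 2 := by nlinarith [hk.1, hk.2]
  have hU0 : 0 < lam ^ 2 / (1 - lam ^ 2) := by positivity
  rw [f_eq_fInt hlam hk rfl, f_eq_fInt hlam hk rfl]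
  exact mul_lt_mul_of_pos_left (fInt_lt_fInt (mul_pos (alpha_pos N) hm).le
    (mul_lt_mul_of_pos_right (alpha_lt_alpha_succ N) hm) hU0) (by positivity)

/-- The `4` is `2 · 2`: one factor from `1 - k² ≤ 2 (1 - k)`, the other from `fInt ≤ 2`; moreover `U
/ lam = lam / (1 - lam²) ≤ 1 / (1 - lam)`. -/
theorem f_le {lam k : ℝ} (hlam : lam ∈ Set.Ioo (0 : ℝ) 1) (hk : k ∈ Set.Ico (0 : ℝ) 1) (N : ℕ) :
    f N lam k ≤ 4 * ((1 - k) / (1 - lam)) := by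
  have h1 : 0 < 1 - lam := by linarith [hlam.2]
  have hl0 := hlam.1
  have hl2 : 0 < 1 - lam ^ 2 := by nlinarith
  have hk1 : 0 < 1 - k := by linarith [hk.2]
  have hm : 0 < 1 - k ^ 2 := by nlinarith [hk.1]
  have hU0 : 0 < lam ^ 2 / (1 - lam ^ 2) := by positivity
  rw [f_eq_fInt hlam hk rfl]
  have h2 : 1 - k ^ 2 ≤ 2 * (1 - k) := by nlinarith
  have h3 : lam ^ 2 / (1 - lam ^ 2) / lam ≤ 1 / (1 - lam) := by
    rw [div_div, div_le_div_iff₀ (by positivity) h1]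
    nlinarith [mul_pos hl0 h1]
  have h4 := fInt_le_two (mul_pos (alpha_pos N) hm).le hU0.le
  have h5 := fInt_pos (mul_pos (alpha_pos N) hm).le hU0
  calc _ ≤ 2 * (1 - k) * (1 / (1 - lam)) * 2 := by gcongr
    _ = _ := by ring

end EllipticExpansion

/-! ### Assembly -/

theorem mainTheorem1 :
    -- inside the unit disc the recursively computed `s_n` are the sums of their power series
    (∀ (n : ℕ) (x : ℝ), |x| < 1 →
      HasSum (fun m : ℕ => EllipticExpansion.sTerm n x (n + 1 + m)) (EllipticExpansion.s n x)) ∧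
    -- the expansion, with the sign of the remainder and its two-sided bound
    (∃ R : ℕ → ℝ → ℝ → ℝ,
      ∀ N : ℕ, 1 ≤ N → ∀ lam ∈ Set.Ioo (0 : ℝ) 1, ∀ k ∈ Set.Icc (0 : ℝ) 1,
        EllipticExpansion.ellipticF lam k = EllipticExpansion.expansion N lam k + R N lam k ∧
        (k < 1 → R N lam k < 0) ∧
        (k = 1 → R N lam k = 0) ∧
        EllipticExpansion.errCoef N k * EllipticExpansion.f (N + 1) lam k ≤ -R N lam k ∧
        -R N lam k ≤ EllipticExpansion.errCoef N k * EllipticExpansion.f N lam k) ∧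
    -- positivity of `f_N` and monotonicity in `N`
    (∀ N : ℕ, 1 ≤ N → ∀ lam ∈ Set.Ioo (0 : ℝ) 1, ∀ k ∈ Set.Ico (0 : ℝ) 1,
      0 < EllipticExpansion.f N lam k ∧
      EllipticExpansion.f (N + 1) lam k < EllipticExpansion.f N lam k) ∧
    -- boundedness of `f_N` wherever `(1 - k) / (1 - lam)` is bounded
    (∀ N : ℕ, 1 ≤ N → ∀ E : Set (ℝ × ℝ), E ⊆ Set.Ioo (0 : ℝ) 1 ×ˢ Set.Icc (0 : ℝ) 1 →
      BddAbove ((fun p : ℝ × ℝ => (1 - p.2) / (1 - p.1)) '' E) →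
      ∃ M : ℝ, ∀ p ∈ E, |EllipticExpansion.f N p.1 p.2| ≤ M) := by
  open EllipticExpansion in
  refine ⟨fun n x hx => ?_, ⟨fun N lam k => -remInt N lam (1 - k ^ 2) (lam ^ 2 / (1 - lam ^ 2)),
    fun N _ lam hlam k hk => ?_⟩, fun N _ lam hlam k hk => ⟨f_pos hlam hk N, f_succ_lt hlam hk N⟩,
    fun N _ E hE hbdd => ?_⟩
  · simpa only [sTerm_eq] using hasSum_s hx n
  · refine ⟨by rw [← sub_eq_add_neg]; exact ellipticF_eq_expansion_sub hlam hk rfl N, ?_⟩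
    have hl0 := hlam.1
    have hl2 : 0 < 1 - lam ^ 2 := by nlinarith [hlam.2]
    have hm : 0 ≤ 1 - k ^ 2 := by nlinarith [hk.1, hk.2]
    have hU0 : 0 < lam ^ 2 / (1 - lam ^ 2) := by positivity
    have hb := remInt_bounds hl0 hm hU0.le N
    rcases hk.2.lt_or_eq with hk1 | rfl
    · have hk' : k ∈ Set.Ico (0 : ℝ) 1 := ⟨hk.1, hk1⟩
      have herr : 0 < errCoef N k := by
        have := poch_pos (show (0 : ℝ) < 1 / 2 by norm_num) (N + 1)
        have : 0 < 1 - k ^ 2 := by nlinarith [hk.1]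
        unfold errCoef
        positivity
      rw [← errCoef_mul_f hlam hk' rfl, ← errCoef_mul_f hlam hk' rfl] at hb
      have hpos := mul_pos herr (f_pos hlam hk' (N + 1))
      exact ⟨fun _ => by linarith [hb.1], fun h => absurd h hk1.ne, by linarith [hb.1],
        by linarith [hb.2]⟩
    -- At `k = 1` the factor `(1 - k²)^(N+1)` annihilates the remainder, and both bounds vanish
    -- because `f` is `0` there by definition.
    · simp [remInt, f]
  · obtain ⟨C, hC⟩ := hbdd
    -- The `0` serves the points with `k = 1`, where `f` vanishes.
    refine ⟨max 0 (4 * C), fun p hp => ?_⟩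
    obtain ⟨hlam, hk⟩ := hE hp
    rcases hk.2.lt_or_eq with hk1 | hk1
    · rw [abs_of_pos (f_pos hlam ⟨hk.1, hk1⟩ N)]
      refine (f_le hlam ⟨hk.1, hk1⟩ N).trans (le_max_of_le_right ?_)
      exact mul_le_mul_of_nonneg_left (hC ⟨p, hp, rfl⟩) (by norm_num)
    · simp [f, hk1]
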